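/- **Setting.** There are $n$ secretaries, totally ordered by quality without ties, and each of them arrives exactly twice. In the *order model*, the $2n$ arrivals come in an order chosen uniformly among the $(2n)!$ possible orders. In the *time model*, the $2n$ arrival times are independent and uniform on $[0,1)$. An online strategy knows $n$. Each arrival is one round, and by any round the strategy has observed, for every round so far, the relative rank of the arriving secretary among the distinct secretaries seen up to that round, whether the visit was his first or his second and, in the time model, the time of the arrival. In each round, based on these observations and on independent randomness, it either continues or irrevocably accepts one secretary who has already arrived and whose second visit is not over (both his first and his second visit count as admissible moments). It wins if it accepts the best of all $n$ secretaries. For $\mu\in[0,1)$, the *threshold algorithm* $A_\mu$ in the time model accepts the arriving secretary at the first moment $t\ge\mu$ at which he is the best of all secretaries seen so far and this is his second visit. A family of strategies, one for each $n$, is *asymptotically optimal* if the difference between the supremum of the winning probabilities of all strategies in the time model and its own winning probability tends to $0$ as $n\to\infty$. **Theorem.** There are real numbers $\mu^*$ and $L$ with $|\mu^*-0.272626|\le 5\cdot 10^{-7}$ and $|L-0.767974|\le 5\cdot10^{-7}$ such that: 1. for $\mu\in[0,1)$, the threshold algorithm $A_\mu$ is asymptotically optimal if and only if $\mu=\mu^*$;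 2. as $n\to\infty$, the winning probability of $A_{\mu^*}$, the supremum of the winning probabilities of all strategies in the time model, and the supremum of the winning probabilities of all strategies in the order model all converge to $L$; 3. for every $\mu$ with $|\mu-0.272626|\le5\cdot10^{-7}$ (in particular for $\mu=\mu^*$ and for $\mu=0.272626$) and every $n\ge1$, the algorithm $A_\mu$ hires the best secretary with probability at least $0.76797$. -/

import Mathlib

open MeasureTheory Filter Topology

noncomputable section

namespace ReturningSecretary

/- Secretaries are labelled by `Fin n` from best to worst: secretary `0` is the best one.
Each secretary arrives twice, so there are `n * 2` arrival events `Fin n × Fin 2` and `n * 2`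
rounds.  An arrival sequence `s : Fin (n * 2) → Fin n` says who arrives in each round.
The labels are never shown to a strategy. -/

/-- The relative rank (`1` is the best), among the distinct secretaries that have arrived up to and
including round `r`, of the secretary who arrives in round `r`. -/
def relRank {n : ℕ} (s : Fin (n * 2) → Fin n) (r : Fin (n * 2)) : ℕ :=
  (Finset.univ.filter fun i : Fin n => i ≤ s r ∧ ∃ q, q ≤ r ∧ s q = i).card

/-- Which visit (`1` = first, `2` = second) of the secretary takes place in round `r`. -/
def visit {n : ℕ} (s : Fin (n * 2) → Fin n) (r : Fin (n * 2)) : ℕ :=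
  (Finset.univ.filter fun q : Fin (n * 2) => q ≤ r ∧ s q = s r).card

/-- What is observed in the rounds up to and including `r`: in each of them, an extra observation
in `α` (the arrival time, or nothing), the relative rank, and whether it is a first or second
visit. -/
abbrev History (n : ℕ) (α : Type) (r : Fin (n * 2)) : Type :=
  Set.Iic r → α × ℕ × ℕ

/-- The history at round `r` of the arrival sequence `s` with extra observations `t`. -/
def history {n : ℕ} {α : Type} (t : Fin (n * 2) → α) (s : Fin (n * 2) → Fin n)
    (r : Fin (n * 2)) : History n α r :=
  fun q => (t q, relRank s q, visit s q)

/-- A (randomized) online strategy that knows `n`.  In round `r`, given a random seed and the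
history, it either continues (`none`), or accepts the secretary who arrived in round `q`, for some
`q ≤ r` (`some q`). -/
structure Strategy (n : ℕ) (α : Type) [MeasurableSpace α] where
  act : (r : Fin (n * 2)) → ℝ → History n α r → Option (Set.Iic r)
  measurableSet_act : ∀ (r : Fin (n * 2)) (a : Option (Set.Iic r)),
    MeasurableSet {p : ℝ × History n α r | act r p.1 p.2 = a}

/-- The strategy `S`, with seed `u`, hires the best secretary.  There is a round `r`, the first one
in which `S` accepts anybody, in which `S` accepts the best secretary; and this happens between
the first and the second visit of that secretary (both included), so he must visit in some round
`≤ r` and in some round `≥ r` (if `r` is itself his first visit, these coincide). -/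
def Strategy.Wins {n : ℕ} {α : Type} [MeasurableSpace α] (S : Strategy n α) (u : ℝ)
    (t : Fin (n * 2) → α) (s : Fin (n * 2) → Fin n) : Prop :=
  ∃ (r : Fin (n * 2)) (q : Set.Iic r),
    (∀ r' < r, S.act r' u (history t s r') = none) ∧
    S.act r u (history t s r) = some q ∧
    (∃ q', r ≤ q' ∧ s q' = s q) ∧
    (∀ i : Fin n, s q ≤ i)

/-- The uniform distribution on `[0, 1)`. -/
def uniform01 : Measure ℝ := volume.restrict (Set.Ico 0 1)

/-! ### The model with a uniformly random order of the `2n` arrivals -/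

/-- The winning probability when each of the `(2n)!` orders of the arrival events is equally
likely; the seed is uniform on `[0, 1)` and independent of the order. -/
def winProbOrder {n : ℕ} (S : Strategy n Unit) : ℝ :=
  (∑ σ : Fin (n * 2) ≃ Fin n × Fin 2,
      uniform01.real {u | S.Wins u (fun _ => ()) (fun r => (σ r).1)}) /
    Fintype.card (Fin (n * 2) ≃ Fin n × Fin 2)

/-- The optimal winning probability with `n` secretaries, uniformly random order. -/
def optimalOrder (n : ℕ) : ℝ := ⨆ S : Strategy n Unit, winProbOrder S

/-! ### The model with independent uniform arrival times -/

/-- Given all arrival times, the arrival event of each round: the events sorted by time. -/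
def arrivalOrder {n : ℕ} (T : Fin n × Fin 2 → ℝ) : Fin (n * 2) ≃ Fin n × Fin 2 :=
  (Tuple.sort (T ∘ finProdFinEquiv.symm)).trans finProdFinEquiv.symm

/-- The winning probability when the `2n` arrival times are independent and uniform on `[0, 1)`;
the strategy also observes the times, and its seed is uniform on `[0, 1)` and independent of
them. -/
def winProb {n : ℕ} (S : Strategy n ℝ) : ℝ :=
  (uniform01.prod (Measure.pi fun _ : Fin n × Fin 2 => uniform01)).real
    {p | S.Wins p.1 (fun r => p.2 (arrivalOrder p.2 r)) (fun r => (arrivalOrder p.2 r).1)}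

/-- The optimal winning probability with `n` secretaries, independent uniform arrival times. -/
def optimal (n : ℕ) : ℝ := ⨆ S : Strategy n ℝ, winProb S

open Classical in
/-- The threshold algorithm with parameter `μ`: accept the arriving secretary as soon as the time
is at least `μ`, he is the best of those seen so far, and this is his second visit. -/
def threshold (n : ℕ) (μ : ℝ) : Strategy n ℝ where
  act r _ h :=
    if μ ≤ (h ⟨r, le_refl r⟩).1 ∧ (h ⟨r, le_refl r⟩).2.1 = 1 ∧ (h ⟨r, le_refl r⟩).2.2 = 2
    then some ⟨r, le_refl r⟩ else none
  measurableSet_act r a := by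
    have hA : MeasurableSet {p : ℝ × History n ℝ r |
        μ ≤ (p.2 ⟨r, le_refl r⟩).1 ∧ (p.2 ⟨r, le_refl r⟩).2.1 = 1 ∧
          (p.2 ⟨r, le_refl r⟩).2.2 = 2} := by
      have h0 : Measurable fun p : ℝ × History n ℝ r => p.2 ⟨r, le_refl r⟩ :=
        (measurable_pi_apply _).comp measurable_snd
      have h1 := measurableSet_le (measurable_const (a := μ)) h0.fst
      have h2 := h0.snd.fst (measurableSet_singleton 1)
      have h3 := h0.snd.snd (measurableSet_singleton 2)
      exact h1.inter (h2.inter h3)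
    let _ : MeasurableSpace (Option (Set.Iic r)) := ⊤
    exact Measurable.ite hA measurable_const measurable_const
      (show MeasurableSet ({a} : Set (Option (Set.Iic r))) from trivial)

/-- A family of strategies, one for each number `n` of secretaries, is asymptotically optimal: its
winning probability falls short of the optimal one by an amount that vanishes as `n → ∞`. -/
def AsymptoticallyOptimal (A : (n : ℕ) → Strategy n ℝ) : Prop :=
  Tendsto (fun n => optimal n - winProb (A n)) atTop (𝓝 0)

end ReturningSecretary

end

/-!
The proof bounds the winning probability of the threshold algorithm from below by an exact
recursion, and that of every strategy from above by linear programming duality.  The two bounds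
meet at the value `limitProb μ` for the threshold `μ` with `rejectRatio μ = 1 / 2`.

*The threshold algorithm.*  The algorithm with threshold `m` wins if and only if the second visit of
the best secretary takes place after `m` and nobody is accepted before his first visit
(`threshold_wins_iff`).  Let `noAcceptProb n m x` be the probability that nobody among `n`
secretaries is accepted before time `x`.  The second best secretary is the best one among the
others, so conditioning on the two visits of the best secretary yields a recursion in `n`
(`noAcceptProb_succ`) and a formula for the winning probability (`winProb_threshold_succ`).  The
recursion is monotone, hence both quantities decrease in `n`.  The limit satisfies the fixed-point
equation of the recursion (`seenProb_mul_noAcceptLim`), which is a first-order linear differential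
equation for its primitive; solving it gives the limit `limitProb m` of the winning probability
(`tendsto_winProb_threshold_limitProb`), which is therefore also a lower bound for every `n`.  Its
derivative is `2 * m * (2 * rejectRatio m - 1)`, with `rejectRatio` strictly decreasing, so `μ` is
its only maximum point (`limitProb_lt`).  The threshold `0`, where the formula degenerates, is
handled by a cruder bound (`tendsto_winProb_threshold_zero`).

*The order model.*  Fix the seed of a strategy.  For a round `r`, let a claim in `r` be the event
that `r` is the second visit of the best secretary so far and that he is accepted by then; a win is
a claim concerning the best secretary of all (`StoppingData`).  There are two constraints.
First, whatever has been observed, the labels are exchangeable, so that the best secretary is among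
those seen with a conditional probability equal to the proportion of secretaries seen
(`prob_and_unseen`).  Secondly, a win in round `r` requires that the first visit of the best
secretary happens in a round `a < r` before which nobody is accepted; as exchanging later
rounds does not change the past, this pair of visits is uniformly distributed over the remaining
pairs of rounds (`prob_mem_of_roundInvariant`, `StoppingData.winAt_le_sum`).  The proportion of
secretaries seen is concentrated around its mean, by a variance bound at finitely many rounds and
monotonicity (`avg_sq_sub_le`, `abs_sub_le_gridDev`).  Hence the probabilities of the claims almost
satisfy a linear program.  The weights `dualWeight μ` are feasible for its dual and have the value
`limitProb μ` (`dualWeight_feasible`, `two_mul_integral_dualTail_zero`), and weak duality gives the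
upper bound (`StoppingData.sum_winAt_le`, `optimalOrder_le`).

*The time model.*  The sorted arrival times are independent of the order of the arrivals, so
knowing them is no better than knowing a random seed, and the optimum of the time model is at most
that of the order model (`optimal_le_optimalOrder`).  It is at least the winning probability of the
threshold algorithm, so all three quantities have the same limit.
-/

noncomputable section

namespace ReturningSecretary

/-! ### The limiting winning probability -/

/-- The probability that a given secretary has arrived at least once before time `t`. -/
def seenProb (t : ℝ) : ℝ := t * (2 - t)

/-- The integral of `seenProb` over `[t, 1]`. -/
def seenTail (t : ℝ) : ℝ := (1 - t) - (1 - t) ^ 3 / 3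

/-- The integral of `seenTail / seenProb ^ 2` over `[t, 1]`, in closed form.  In the limit of many
secretaries it is half the ratio of the value of rejecting a best-so-far secretary at his second
visit at time `t`, and accepting the next one in this position, to the value of accepting him. -/
def rejectRatio (t : ℝ) : ℝ :=
  (2 / 3 * (1 / seenProb t - 1) - 1 / 3 * Real.log (seenProb t)) / 2

/-- The limit of the winning probability of the threshold algorithm, as a function of the
threshold. -/
def limitProb (m : ℝ) : ℝ := 2 * seenTail m / (2 - m) + 2 * m ^ 2 * rejectRatio m

lemma seenProb_pos {t : ℝ} (h0 : 0 < t) (h1 : t ≤ 1) : 0 < seenProb t := by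
  unfold seenProb; nlinarith

lemma seenTail_nonneg {t : ℝ} (h0 : 0 ≤ t) (h1 : t ≤ 1) : 0 ≤ seenTail t := by
  unfold seenTail
  have : 0 ≤ (1 - t) * (3 - (1 - t) ^ 2) := by apply mul_nonneg <;> nlinarith
  nlinarith

lemma seenTail_pos {t : ℝ} (h0 : 0 ≤ t) (h1 : t < 1) : 0 < seenTail t := by
  unfold seenTail
  have : 0 < (1 - t) * (3 - (1 - t) ^ 2) := by apply mul_pos <;> nlinarith
  nlinarith

lemma hasDerivAt_seenProb (t : ℝ) : HasDerivAt seenProb (2 * (1 - t)) t := by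
  have := (hasDerivAt_id t).mul ((hasDerivAt_id t).const_sub 2)
  refine this.congr_deriv ?_
  simp; ring

lemma hasDerivAt_seenTail (t : ℝ) : HasDerivAt seenTail (-seenProb t) t := by
  have h := (hasDerivAt_id t).const_sub 1
  have := h.sub ((h.pow 3).div_const 3)
  refine this.congr_deriv ?_
  simp [seenProb]; ring

lemma hasDerivAt_rejectRatio {t : ℝ} (h0 : 0 < t) (h1 : t ≤ 1) :
    HasDerivAt rejectRatio (-(seenTail t / seenProb t ^ 2)) t := by
  have hD := (seenProb_pos h0 h1).ne'
  have h := hasDerivAt_seenProb t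
  have := (((((hasDerivAt_const t (1 : ℝ)).div h hD).sub_const 1).const_mul (2 / 3)).sub
    ((h.log hD).const_mul (1 / 3))).div_const 2
  refine this.congr_deriv ?_
  have : seenTail t = (1 - t) * (2 + seenProb t) / 3 := by unfold seenTail seenProb; ring
  rw [this]; field_simp; ring

lemma continuousOn_rejectRatio : ContinuousOn rejectRatio (Set.Ioc 0 1) := fun _ ht =>
  (hasDerivAt_rejectRatio ht.1 ht.2).continuousAt.continuousWithinAt

lemma strictAntiOn_rejectRatio : StrictAntiOn rejectRatio (Set.Ioc 0 1) := by
  apply strictAntiOn_of_deriv_neg (convex_Ioc 0 1) continuousOn_rejectRatio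
  intro t ht
  rw [interior_Ioc] at ht
  rw [(hasDerivAt_rejectRatio ht.1 ht.2.le).deriv]
  have := seenProb_pos ht.1 ht.2.le
  have := seenTail_pos ht.1.le ht.2
  have : 0 < seenTail t / seenProb t ^ 2 := by positivity
  linarith

@[simp] lemma rejectRatio_one : rejectRatio 1 = 0 := by
  unfold rejectRatio seenProb; norm_num

lemma hasDerivAt_limitProb {m : ℝ} (h0 : 0 < m) (h1 : m ≤ 1) :
    HasDerivAt limitProb (2 * m * (2 * rejectRatio m - 1)) m := by
  have hm : (2 - m) ≠ 0 := by linarith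
  have := (((hasDerivAt_seenTail m).const_mul 2).div ((hasDerivAt_id m).const_sub 2) hm).add
    ((((hasDerivAt_id m).pow 2).const_mul 2).mul (hasDerivAt_rejectRatio h0 h1))
  refine this.congr_deriv ?_
  simp only [seenProb, id, Pi.pow_apply]
  field_simp
  ring

/-- The threshold at which accepting and rejecting are equally good is the only maximum point of
the limiting winning probability. -/
lemma limitProb_lt {μ m : ℝ} (hμ0 : 0 < μ) (hμ1 : μ < 1) (hμ : rejectRatio μ = 1 / 2)
    (hm0 : 0 < m) (hm1 : m < 1) (hne : m ≠ μ) : limitProb m < limitProb μ := by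
  have hc : ContinuousOn limitProb (Set.Ioc 0 1) := fun _ ht =>
    (hasDerivAt_limitProb ht.1 ht.2).continuousAt.continuousWithinAt
  rcases lt_or_gt_of_ne hne with h | h
  · have : StrictMonoOn limitProb (Set.Ioc 0 μ) := by
      apply strictMonoOn_of_deriv_pos (convex_Ioc 0 μ)
        (hc.mono fun x hx => ⟨hx.1, by linarith [hx.2]⟩)
      intro t ht
      rw [interior_Ioc] at ht
      rw [(hasDerivAt_limitProb ht.1 (by linarith [ht.2])).deriv]
      have := strictAntiOn_rejectRatio ⟨ht.1, by linarith [ht.2]⟩ ⟨hμ0, hμ1.le⟩ ht.2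
      have := ht.1
      apply mul_pos <;> linarith
    exact this ⟨hm0, h.le⟩ ⟨hμ0, le_rfl⟩ h
  · have : StrictAntiOn limitProb (Set.Ico μ 1) := by
      apply strictAntiOn_of_deriv_neg (convex_Ico μ 1)
        (hc.mono fun x hx => ⟨by linarith [hx.1], hx.2.le⟩)
      intro t ht
      rw [interior_Ico] at ht
      have h0 : 0 < t := by linarith [ht.1]
      rw [(hasDerivAt_limitProb h0 ht.2.le).deriv]
      have := strictAntiOn_rejectRatio ⟨hμ0, hμ1.le⟩ ⟨h0, ht.2.le⟩ ht.1
      apply mul_neg_of_pos_of_neg <;> linarith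
    exact this ⟨le_rfl, hμ1⟩ ⟨h.le, hm1⟩ h

/-! ### Numerical bounds -/

/-- The value comes from `0.47 = 0.94 / 2` and the Taylor series at `1`. -/
lemma abs_log_047_sub_le : |Real.log 0.47 - (-0.7550225842780328)| ≤ 0.000000002 := by
  have e : Real.log 0.47 = - Real.log 2 + Real.log (1 - 0.06) := by
    rw [← Real.log_inv, ← Real.log_mul] <;> norm_num
  have h1 := Real.log_two_gt_d9
  have h2 := Real.log_two_lt_d9
  have h3 := Real.abs_log_sub_add_sum_range_le (x := (0.06 : ℝ)) (by norm_num) 8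
  rw [e]
  rw [abs_le] at h3 ⊢
  rw [abs_of_pos (by norm_num)] at h3
  norm_num [Finset.sum_range_succ] at h3 ⊢
  constructor <;> linarith [h3.1, h3.2]

/-- The logarithm near `0.47`, which is close to the value of `seenProb` at the optimal
threshold. -/
lemma abs_log_sub_le {y : ℝ} (h0 : 0 ≤ y) (h1 : y ≤ 0.0021) :
    |Real.log (0.47 * (1 + y)) - (-0.7550225842780328 + y - y ^ 2 / 2)| ≤ 0.00000002 := by
  have e : Real.log (0.47 * (1 + y)) = Real.log 0.47 + Real.log (1 - (-y)) := by
    rw [← Real.log_mul (by norm_num) (by linarith), sub_neg_eq_add]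
  have h3 := Real.abs_log_sub_add_sum_range_le (x := -y)
    (by rw [abs_neg, abs_of_nonneg h0]; linarith) 2
  have h4 := abs_le.1 abs_log_047_sub_le
  rw [abs_neg, abs_of_nonneg h0] at h3
  have h5 : y ^ (2 + 1) / (1 - y) ≤ 0.0021 ^ 3 / 0.9 := by gcongr; linarith
  have h6 := abs_le.1 (h3.trans h5)
  rw [e, abs_le]
  norm_num [Finset.sum_range_succ] at h6 h4 ⊢
  constructor <;> linarith [h6.1, h6.2]

lemma rejectRatio_lower : 1 / 2 < rejectRatio 0.2726255 := by
  have h := abs_le.1 (abs_log_sub_le (y := 0.2726255 * (2 - 0.2726255) / 0.47 - 1)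
    (by norm_num) (by norm_num))
  unfold rejectRatio seenProb
  norm_num at h ⊢
  linarith [h.1, h.2]

lemma rejectRatio_upper : rejectRatio 0.272626 < 1 / 2 := by
  have h := abs_le.1 (abs_log_sub_le (y := 0.272626 * (2 - 0.272626) / 0.47 - 1)
    (by norm_num) (by norm_num))
  unfold rejectRatio seenProb
  norm_num at h ⊢
  linarith [h.1, h.2]

lemma rejectRatio_upper_end : 0.49999 < rejectRatio 0.2726265 := by
  have h := abs_le.1 (abs_log_sub_le (y := 0.2726265 * (2 - 0.2726265) / 0.47 - 1)
    (by norm_num) (by norm_num))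
  unfold rejectRatio seenProb
  norm_num at h ⊢
  linarith [h.1, h.2]

lemma exists_rejectRatio_eq_half :
    ∃ μ : ℝ, 0.2726255 ≤ μ ∧ μ ≤ 0.272626 ∧ rejectRatio μ = 1 / 2 := by
  have hc : ContinuousOn rejectRatio (Set.Icc 0.2726255 0.272626) :=
    continuousOn_rejectRatio.mono fun x hx => ⟨by linarith [hx.1], by linarith [hx.2]⟩
  obtain ⟨μ, h1, h2⟩ := intermediate_value_Icc' (by norm_num) hc
    ⟨rejectRatio_upper.le, rejectRatio_lower.le⟩
  exact ⟨μ, h1.1, h1.2, h2⟩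

lemma limitProb_eq {μ : ℝ} (hμ : rejectRatio μ = 1 / 2) :
    limitProb μ = 2 * seenTail μ / (2 - μ) + μ ^ 2 := by
  rw [limitProb, hμ]; ring

lemma abs_limitProb_sub_le {μ : ℝ} (h1 : 0.2726255 ≤ μ) (h2 : μ ≤ 0.272626)
    (hμ : rejectRatio μ = 1 / 2) : |limitProb μ - 0.767974| ≤ 0.0000005 := by
  rw [limitProb_eq hμ, abs_le]
  have hp : 0 < 2 - μ := by linarith
  have e : 2 * seenTail μ / (2 - μ) + μ ^ 2 - 0.767974
      = (2 * seenTail μ - (2 - μ) * (0.767974 - μ ^ 2)) / (2 - μ) := by field_simp; ring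
  rw [e, le_div_iff₀ hp, div_le_iff₀ hp]
  unfold seenTail
  obtain ⟨d, rfl⟩ : ∃ d, μ = 0.2726255 + d := ⟨μ - 0.2726255, by ring⟩
  have hd0 : 0 ≤ d := by linarith
  have hd1 : d ≤ 0.0000005 := by linarith
  have hd2 : d ^ 2 ≤ 0.0000005 * d := by nlinarith
  have hd3 : d ^ 3 ≤ 0.0000005 * d := by nlinarith
  have hd3' : 0 ≤ d ^ 3 := by positivity
  constructor <;> nlinarith

lemma le_limitProb_of_abs_le {m : ℝ} (hm : |m - 0.272626| ≤ 0.0000005) :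
    0.76797 ≤ limitProb m := by
  rw [abs_le] at hm
  have h1 : 0.2726255 ≤ m := by linarith [hm.1]
  have h2 : m ≤ 0.2726265 := by linarith [hm.2]
  have hr : 0.49999 ≤ rejectRatio m := rejectRatio_upper_end.le.trans
    (strictAntiOn_rejectRatio.antitoneOn ⟨by linarith, by linarith⟩ ⟨by norm_num, by norm_num⟩ h2)
  have hp : 0 < 2 - m := by linarith
  have : 2 * seenTail m / (2 - m) + 2 * m ^ 2 * 0.49999 ≤ limitProb m := by
    unfold limitProb; gcongr
  refine le_trans ?_ this
  have e : 2 * seenTail m / (2 - m) + 2 * m ^ 2 * 0.49999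
      = (2 * seenTail m + (2 - m) * (2 * m ^ 2 * 0.49999)) / (2 - m) := by field_simp
  rw [e, le_div_iff₀ hp]
  unfold seenTail
  obtain ⟨d, rfl⟩ : ∃ d, m = 0.2726255 + d := ⟨m - 0.2726255, by ring⟩
  have hd0 : 0 ≤ d := by linarith
  have hd1 : d ≤ 0.000001 := by linarith
  have hd2 : d ^ 2 ≤ 0.000001 * d := by nlinarith
  have hd3 : d ^ 3 ≤ 0.000001 * d := by nlinarith
  have hd3' : 0 ≤ d ^ 3 := by positivity
  nlinarith

section

/-! ### The dual weights -/

/-- The optimal solution of the linear program dual to the stopping problem, in the limit of many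
secretaries.  With stopping density `p` at the second visits of best-so-far secretaries, the primal
problem is to maximize `∫ seenProb * p` subject to
`seenProb t * p t ≤ 2 * ∫ a in 0..t, (1 - ∫ s in 0..a, p s)`. -/
def dualWeight (μ t : ℝ) : ℝ := if t < μ then 0 else 1 - 2 * rejectRatio t

variable {μ : ℝ}

lemma monotoneOn_dualWeight (h0 : 0 < μ) (h1 : μ < 1) (hμ : rejectRatio μ = 1 / 2) :
    MonotoneOn (dualWeight μ) (Set.Icc 0 1) := by
  intro x hx y hy hxy
  have hanti := strictAntiOn_rejectRatio.antitoneOn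
  unfold dualWeight
  split_ifs with hx' hy' hy'
  · rfl
  · push Not at hy'
    have := hanti ⟨h0, h1.le⟩ ⟨by linarith, hy.2⟩ hy'
    linarith
  · linarith
  · push Not at hx' hy'
    have := hanti ⟨by linarith, hx.2⟩ ⟨by linarith, hy.2⟩ hxy
    linarith

lemma dualWeight_zero (h0 : 0 < μ) : dualWeight μ 0 = 0 := if_pos h0

lemma dualWeight_one (h1 : μ < 1) : dualWeight μ 1 = 1 := by
  simp [dualWeight, h1.le]

lemma dualWeight_mem (h0 : 0 < μ) (h1 : μ < 1) (hμ : rejectRatio μ = 1 / 2) {t : ℝ}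
    (ht : t ∈ Set.Icc (0 : ℝ) 1) : dualWeight μ t ∈ Set.Icc (0 : ℝ) 1 := by
  have h := monotoneOn_dualWeight h0 h1 hμ
  constructor
  · rw [← dualWeight_zero h0]; exact h (by simp) ht ht.1
  · rw [← dualWeight_one h1]; exact h ht (by simp) ht.2

/-- The function `t ↦ dualWeight μ t * (t - s)⁺`, whose integral bounds the future
contribution of the dual weights at time `s`. -/
def dualTail (μ s t : ℝ) : ℝ := dualWeight μ t * max (t - s) 0

lemma monotoneOn_dualTail (h0 : 0 < μ) (h1 : μ < 1) (hμ : rejectRatio μ = 1 / 2) (s : ℝ) :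
    MonotoneOn (dualTail μ s) (Set.Icc 0 1) := by
  intro x hx y hy hxy
  unfold dualTail
  have h := monotoneOn_dualWeight h0 h1 hμ hx hy hxy
  have h2 := (dualWeight_mem h0 h1 hμ hy).1
  gcongr

/-- The function `seenProb * rejectRatio` has second derivative `1 - 2 * rejectRatio`. -/
lemma integral_one_sub_rejectRatio {c : ℝ} (s : ℝ) (h0 : 0 < c) (h1 : c ≤ 1) :
    ∫ t in c..1, (1 - 2 * rejectRatio t) * (t - s) =
      seenProb c * rejectRatio c -
        (2 * (1 - c) * rejectRatio c - seenTail c / seenProb c) * (c - s) := by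
  have hd : ∀ t ∈ Set.uIcc c 1, HasDerivAt
      (fun t => (2 * (1 - t) * rejectRatio t - seenTail t / seenProb t) * (t - s)
        - seenProb t * rejectRatio t) ((1 - 2 * rejectRatio t) * (t - s)) t := by
    intro t ht
    rw [Set.uIcc_of_le h1] at ht
    have ht0 : 0 < t := by linarith [ht.1]
    have hD := (seenProb_pos ht0 ht.2).ne'
    have hH := hasDerivAt_rejectRatio ht0 ht.2
    have := ((((((hasDerivAt_id t).const_sub 1).const_mul 2).mul hH).sub
      ((hasDerivAt_seenTail t).div (hasDerivAt_seenProb t) hD)).mul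
        ((hasDerivAt_id t).sub_const s)).sub ((hasDerivAt_seenProb t).mul hH)
    refine this.congr_deriv ?_
    simp only [id, Pi.mul_apply, Pi.sub_apply, Pi.div_apply]
    field_simp
    ring
  rw [intervalIntegral.integral_eq_sub_of_hasDerivAt hd]
  · simp [seenTail]
  · apply ContinuousOn.intervalIntegrable
    rw [Set.uIcc_of_le h1]
    have : ContinuousOn rejectRatio (Set.Icc c 1) :=
      continuousOn_rejectRatio.mono fun x hx => ⟨by linarith [hx.1], hx.2⟩
    fun_prop

lemma integral_dualTail (h0 : 0 < μ) (h1 : μ < 1) (hμ : rejectRatio μ = 1 / 2) {s : ℝ}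
    (hs1 : s ≤ 1) :
    ∫ t in (0:ℝ)..1, dualTail μ s t =
      seenProb (max s μ) * rejectRatio (max s μ) -
        (2 * (1 - max s μ) * rejectRatio (max s μ) - seenTail (max s μ) / seenProb (max s μ))
          * (max s μ - s) := by
  have hc0 : 0 < max s μ := lt_max_of_lt_right h0
  have hc1 : max s μ ≤ 1 := max_le hs1 h1.le
  have hm := monotoneOn_dualTail h0 h1 hμ s
  rw [← integral_one_sub_rejectRatio s hc0 hc1,
    ← intervalIntegral.integral_add_adjacent_intervals (b := max s μ)]
  · have e1 : ∫ t in (0:ℝ)..(max s μ), dualTail μ s t = ∫ t in (0:ℝ)..(max s μ), (0:ℝ) := by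
      apply intervalIntegral.integral_congr
      intro t ht
      rw [Set.uIcc_of_le hc0.le] at ht
      show dualTail μ s t = 0
      unfold dualTail dualWeight
      rcases le_total t s with h | h
      · rw [max_eq_right (by linarith)]; simp
      split_ifs with h'
      · simp
      push Not at h'
      rcases le_max_iff.1 ht.2 with h2 | h2
      · rw [max_eq_right (by linarith)]; simp
      · rw [le_antisymm h2 h', hμ]; simp
    have e2 : ∫ t in (max s μ)..1, dualTail μ s t =
        ∫ t in (max s μ)..1, (1 - 2 * rejectRatio t) * (t - s) := by
      apply intervalIntegral.integral_congr
      intro t ht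
      rw [Set.uIcc_of_le hc1] at ht
      have := max_le_iff.1 ht.1
      show dualTail μ s t = _
      unfold dualTail dualWeight
      rw [if_neg (by linarith), max_eq_left (by linarith)]
    rw [e1, e2]; simp
  · apply MonotoneOn.intervalIntegrable
    rw [Set.uIcc_of_le hc0.le]
    exact hm.mono (Set.Icc_subset_Icc le_rfl hc1)
  · apply MonotoneOn.intervalIntegrable
    rw [Set.uIcc_of_le hc1]
    exact hm.mono (Set.Icc_subset_Icc hc0.le le_rfl)

/-- The dual weights are feasible, with equality from the threshold on. -/
lemma dualWeight_feasible (h0 : 0 < μ) (h1 : μ < 1) (hμ : rejectRatio μ = 1 / 2) {s : ℝ}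
    (hs1 : s ≤ 1) :
    (1 - dualWeight μ s) * seenProb s ≤ 2 * ∫ t in (0:ℝ)..1, dualTail μ s t := by
  rw [integral_dualTail h0 h1 hμ hs1]
  unfold dualWeight
  split_ifs with h
  · rw [max_eq_right h.le, hμ]
    have h2 : 0 ≤ seenTail μ / seenProb μ * (μ - s) := by
      have := seenTail_nonneg h0.le h1.le
      have := seenProb_pos h0 h1.le
      have : 0 ≤ μ - s := by linarith
      positivity
    have h3 : seenProb s = seenProb μ - 2 * (1 - μ) * (μ - s) - (μ - s) ^ 2 := by
      unfold seenProb; ring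
    nlinarith [sq_nonneg (μ - s)]
  · rw [max_eq_left (by linarith)]
    apply le_of_eq; ring

/-- The value of the dual program. -/
lemma two_mul_integral_dualTail_zero (h0 : 0 < μ) (h1 : μ < 1) (hμ : rejectRatio μ = 1 / 2) :
    2 * ∫ t in (0:ℝ)..1, dualTail μ 0 t = limitProb μ := by
  rw [integral_dualTail h0 h1 hμ zero_le_one, max_eq_right h0.le, limitProb_eq hμ, hμ]
  have : (2 - μ) ≠ 0 := by linarith
  have := h0.ne'
  unfold seenProb
  field_simp
  ring

/-- A Riemann sum of a monotone function on `[0, 1]` with left end points. -/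
lemma sum_range_le_integral {f : ℝ → ℝ} (hf : MonotoneOn f (Set.Icc 0 1)) {N : ℕ} (hN : 0 < N) :
    (∑ r ∈ Finset.range N, f (r / N)) ≤ N * ∫ t in (0:ℝ)..1, f t ∧
      N * (∫ t in (0:ℝ)..1, f t) - (f 1 - f 0) ≤ ∑ r ∈ Finset.range N, f (r / N) := by
  have hN' : (0:ℝ) < N := by exact_mod_cast hN
  have hg : MonotoneOn (fun x : ℝ => f (x / N)) (Set.Icc 0 (0 + N)) := by
    intro x hx y hy hxy
    rw [zero_add] at hx hy
    apply hf ⟨by have := hx.1; positivity, (div_le_one hN').2 hx.2⟩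
      ⟨by have := hy.1; positivity, (div_le_one hN').2 hy.2⟩
    gcongr
  have e : ∫ x in (0:ℝ)..(0 + N), f (x / N) = N * ∫ t in (0:ℝ)..1, f t := by
    rw [intervalIntegral.integral_comp_div _ hN'.ne']
    simp [hN'.ne']
  have h1 := hg.sum_le_integral
  have h2 := hg.integral_le_sum
  rw [e] at h1 h2
  simp only [zero_add] at h1 h2
  refine ⟨h1, ?_⟩
  have h3 := Finset.sum_range_succ (fun r : ℕ => f (r / N)) N
  have h4 := Finset.sum_range_succ' (fun r : ℕ => f (r / N)) N
  simp [hN'.ne'] at h3 h4 h2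
  linarith

end

section

/-! ### Uniformly random orders -/

/-- An order of the arrival events. -/
abbrev ArrivalSeq (n : ℕ) : Type := Fin (n * 2) ≃ Fin n × Fin 2

open Classical in
/-- The indicator of a proposition, as a real number. -/
def ind (p : Prop) : ℝ := if p then 1 else 0

/-- The expectation of a random variable under a uniformly random order of the arrival events. -/
def avg {n : ℕ} (f : ArrivalSeq n → ℝ) : ℝ := (∑ σ, f σ) / Fintype.card (ArrivalSeq n)

/-- The probability of an event under a uniformly random order of the arrival events. -/
def prob {n : ℕ} (A : ArrivalSeq n → Prop) : ℝ := avg fun σ => ind (A σ)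

lemma ind_of_true {p : Prop} (h : p) : ind p = 1 := if_pos h

lemma ind_of_false {p : Prop} (h : ¬ p) : ind p = 0 := if_neg h

lemma ind_nonneg (p : Prop) : 0 ≤ ind p := by unfold ind; split_ifs <;> norm_num

lemma ind_le_one (p : Prop) : ind p ≤ 1 := by unfold ind; split_ifs <;> norm_num

lemma ind_mono {p q : Prop} (h : p → q) : ind p ≤ ind q := by
  unfold ind; split_ifs <;> first | tauto | norm_num

lemma ind_and (p q : Prop) : ind (p ∧ q) = ind p * ind q := by
  unfold ind; split_ifs <;> simp_all

variable {n : ℕ}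

instance : Nonempty (ArrivalSeq n) := ⟨finProdFinEquiv.symm⟩

lemma card_arrivalSeq_pos : (0 : ℝ) < Fintype.card (ArrivalSeq n) := by
  exact_mod_cast Fintype.card_pos

lemma avg_mono {f g : ArrivalSeq n → ℝ} (h : ∀ σ, f σ ≤ g σ) : avg f ≤ avg g := by
  unfold avg
  gcongr
  exact h _

lemma avg_add (f g : ArrivalSeq n → ℝ) : avg (fun σ => f σ + g σ) = avg f + avg g := by
  unfold avg; rw [Finset.sum_add_distrib, add_div]

lemma avg_sub (f g : ArrivalSeq n → ℝ) : avg (fun σ => f σ - g σ) = avg f - avg g := by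
  unfold avg; rw [Finset.sum_sub_distrib, sub_div]

lemma avg_const_mul (c : ℝ) (f : ArrivalSeq n → ℝ) : avg (fun σ => c * f σ) = c * avg f := by
  unfold avg; rw [← Finset.mul_sum, mul_div_assoc]

lemma avg_sum {ι : Type*} (s : Finset ι) (f : ι → ArrivalSeq n → ℝ) :
    avg (fun σ => ∑ i ∈ s, f i σ) = ∑ i ∈ s, avg (f i) := by
  unfold avg; rw [Finset.sum_comm, Finset.sum_div]

lemma avg_const (c : ℝ) : avg (fun _ : ArrivalSeq n => c) = c := by
  unfold avg
  have := (card_arrivalSeq_pos (n := n)).ne'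
  simp only [Finset.sum_const, Finset.card_univ, nsmul_eq_mul]
  field_simp

lemma avg_comp (e : Equiv.Perm (ArrivalSeq n)) (f : ArrivalSeq n → ℝ) :
    avg (fun σ => f (e σ)) = avg f := by
  unfold avg; rw [Equiv.sum_comp e f]

lemma prob_nonneg (A : ArrivalSeq n → Prop) : 0 ≤ prob A := by
  rw [← avg_const (n := n) 0]; exact avg_mono fun _ => ind_nonneg _

lemma prob_le_one (A : ArrivalSeq n → Prop) : prob A ≤ 1 := by
  rw [← avg_const (n := n) 1]; exact avg_mono fun _ => ind_le_one _

lemma prob_mono {A B : ArrivalSeq n → Prop} (h : ∀ σ, A σ → B σ) : prob A ≤ prob B :=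
  avg_mono fun σ => ind_mono (h σ)

lemma prob_and_add_prob_and_not (A B : ArrivalSeq n → Prop) :
    prob (fun σ => A σ ∧ B σ) + prob (fun σ => A σ ∧ ¬ B σ) = prob A := by
  unfold prob
  rw [← avg_add]
  congr 1; ext σ
  by_cases hA : A σ <;> by_cases hB : B σ <;> simp [ind, hA, hB]

/-- None of the secretaries in `T` arrives in the first `m` rounds. -/
def Unseen (T : Finset (Fin n)) (m : ℕ) (σ : ArrivalSeq n) : Prop :=
  ∀ q : Fin (n * 2), (q : ℕ) < m → (σ q).1 ∉ T

/-- The proportion of the secretaries that do not arrive in the first `m` rounds. -/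
def unseenFrac (m : ℕ) (σ : ArrivalSeq n) : ℝ := (∑ i : Fin n, ind (Unseen {i} m σ)) / n

/-! ### Symmetry of the rounds -/

/-- The event `A` is invariant under exchanging two rounds after the first `m`. -/
def RoundInvariant (m : ℕ) (A : ArrivalSeq n → Prop) : Prop :=
  ∀ p q : Fin (n * 2), m ≤ p → m ≤ q → ∀ σ, A σ → A ((Equiv.swap p q).trans σ)

lemma sum_ind_mem (T : Finset (Fin n)) (σ : ArrivalSeq n) :
    ∑ p, ind ((σ p).1 ∈ T) = 2 * T.card := by
  rw [Equiv.sum_comp σ fun e => ind (e.1 ∈ T), Fintype.sum_prod_type]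
  simp [ind, ← two_mul, mul_comm]

lemma card_filter_le (m : ℕ) (hm : m ≤ n * 2) :
    ((Finset.univ.filter (fun p : Fin (n * 2) => m ≤ (p : ℕ))).card : ℝ) = (n * 2 : ℕ) - m := by
  have h := Finset.card_filter_add_card_filter_not (s := (Finset.univ : Finset (Fin (n * 2))))
    (fun p => (p : ℕ) < m)
  rw [Fin.card_filter_val_lt, min_eq_right hm, Finset.card_univ, Fintype.card_fin,
    Finset.filter_congr (q := fun p : Fin (n * 2) => m ≤ (p : ℕ)) (fun p _ => not_lt)] at h
  have h' := congrArg (Nat.cast : ℕ → ℝ) h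
  push_cast at h' ⊢
  linarith

/-- If exactly `c` visits of secretaries in `T` take place in the first `m` rounds on the event `A`,
then, on `A`, the other visits are spread uniformly over the remaining rounds. -/
lemma prob_mem_of_roundInvariant {m : ℕ} {A : ArrivalSeq n → Prop} (hA : RoundInvariant m A)
    (T : Finset (Fin n)) (c : ℝ)
    (hc : ∀ σ, A σ →
      ∑ p ∈ Finset.univ.filter (fun p : Fin (n * 2) => (p : ℕ) < m), ind ((σ p).1 ∈ T) = c)
    (p : Fin (n * 2)) (hp : m ≤ p) :
    ((n * 2 : ℕ) - m) * prob (fun σ => A σ ∧ (σ p).1 ∈ T) = (2 * T.card - c) * prob A := by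
  have h1 : ∀ p' : Fin (n * 2), m ≤ p' →
      prob (fun σ => A σ ∧ (σ p').1 ∈ T) = prob (fun σ => A σ ∧ (σ p).1 ∈ T) := by
    intro p' hp'
    unfold prob
    rw [← avg_comp (Equiv.equivCongr (Equiv.swap p p') (Equiv.refl _))
      (fun σ => ind (A σ ∧ (σ p).1 ∈ T))]
    congr 1; ext σ
    have e : Equiv.equivCongr (Equiv.swap p p') (Equiv.refl _) σ = (Equiv.swap p p').trans σ := by
      ext <;> simp
    rw [e]
    congr 1
    simp only [Equiv.trans_apply, Equiv.swap_apply_left, eq_iff_iff, and_congr_left_iff]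
    intro _
    refine ⟨hA p p' hp hp' σ, fun h => ?_⟩
    have := hA p p' hp hp' _ h
    rwa [← Equiv.trans_assoc, ← Equiv.Perm.mul_def, Equiv.swap_mul_self] at this
  have h2 : ∑ p' ∈ Finset.univ.filter (fun p : Fin (n * 2) => m ≤ (p : ℕ)),
      prob (fun σ => A σ ∧ (σ p').1 ∈ T) = (2 * T.card - c) * prob A := by
    unfold prob
    rw [← avg_sum, ← avg_const_mul]
    congr 1; ext σ
    simp only [ind_and]
    rw [← Finset.mul_sum, mul_comm]
    by_cases h : A σ
    · rw [← hc σ h, ← sum_ind_mem T σ,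
        ← Finset.sum_filter_add_sum_filter_not Finset.univ (fun p : Fin (n * 2) => (p : ℕ) < m)]
      simp only [not_lt]
      ring
    · rw [ind_of_false h]; ring
  rw [← h2, Finset.sum_congr rfl fun p' hp' => h1 p' (Finset.mem_filter.1 hp').2,
    Finset.sum_const, nsmul_eq_mul, card_filter_le m (hp.trans p.2.le)]

lemma roundInvariant_unseen (T : Finset (Fin n)) (m : ℕ) : RoundInvariant m (Unseen T m) := by
  intro p q hp hq σ h r hr
  rw [Equiv.trans_apply, Equiv.swap_apply_of_ne_of_ne]
  · exact h r hr
  · rintro rfl; omega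
  · rintro rfl; omega

lemma RoundInvariant.and {m : ℕ} {A B : ArrivalSeq n → Prop} (hA : RoundInvariant m A)
    (hB : RoundInvariant m B) : RoundInvariant m (fun σ => A σ ∧ B σ) :=
  fun p q hp hq σ h => ⟨hA p q hp hq σ h.1, hB p q hp hq σ h.2⟩

lemma RoundInvariant.mono {m m' : ℕ} (hm : m ≤ m') {A : ArrivalSeq n → Prop}
    (hA : RoundInvariant m A) : RoundInvariant m' A :=
  fun p q hp hq => hA p q (hm.trans hp) (hm.trans hq)

lemma Unseen.sum_eq_zero {T : Finset (Fin n)} {m : ℕ} {σ : ArrivalSeq n} (h : Unseen T m σ) :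
    ∑ p ∈ Finset.univ.filter (fun p : Fin (n * 2) => (p : ℕ) < m), ind ((σ p).1 ∈ T) = 0 :=
  Finset.sum_eq_zero fun p hp => ind_of_false (h p (Finset.mem_filter.1 hp).2)

lemma unseen_succ_iff {T : Finset (Fin n)} {m : ℕ} (hm : m < n * 2) {σ : ArrivalSeq n} :
    Unseen T (m + 1) σ ↔ Unseen T m σ ∧ (σ ⟨m, hm⟩).1 ∉ T := by
  constructor
  · exact fun h => ⟨fun q hq => h q (by omega), h ⟨m, hm⟩ (by simp)⟩
  · rintro ⟨h1, h2⟩ q hq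
    rcases Nat.lt_succ_iff_lt_or_eq.1 hq with h | h
    · exact h1 q h
    · have : q = ⟨m, hm⟩ := Fin.ext h
      rwa [this]

lemma prob_unseen_succ (T : Finset (Fin n)) {m : ℕ} (hm : m < n * 2) :
    ((n * 2 : ℕ) - m) * prob (Unseen T (m + 1)) =
      ((n * 2 : ℕ) - m - 2 * T.card) * prob (Unseen T m) := by
  have h1 := prob_mem_of_roundInvariant (roundInvariant_unseen T m) T 0
    (fun σ h => h.sum_eq_zero) ⟨m, hm⟩ le_rfl
  have h2 := prob_and_add_prob_and_not (Unseen T m) (fun σ => (σ ⟨m, hm⟩).1 ∈ T)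
  have h3 : Unseen T (m + 1) = fun σ => Unseen T m σ ∧ ¬ (σ ⟨m, hm⟩).1 ∈ T := by
    ext σ; exact unseen_succ_iff hm
  rw [h3]
  linear_combination (((n * 2 : ℕ) : ℝ) - m) * h2 - h1

lemma prob_unseen_zero (T : Finset (Fin n)) : prob (Unseen T 0) = 1 := by
  rw [← avg_const (n := n) 1]
  unfold prob
  congr 1; ext σ
  exact ind_of_true fun q hq => absurd hq (by omega)

/-- The probability that a given secretary does not arrive in the first `m` rounds. -/
lemma prob_unseen_singleton (i : Fin n) {m : ℕ} (hm : m ≤ n * 2) :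
    ((n * 2 : ℕ) : ℝ) * ((n * 2 : ℕ) - 1) * prob (Unseen {i} m) =
      ((n * 2 : ℕ) - m) * ((n * 2 : ℕ) - m - 1) := by
  induction m with
  | zero => rw [prob_unseen_zero]; push_cast; ring
  | succ m ih =>
    have h := prob_unseen_succ {i} (m := m) (by omega)
    have h2 := ih (by omega)
    have h3 : (((n * 2 : ℕ) : ℝ) - m) ≠ 0 := by
      have : (m : ℝ) < ((n * 2 : ℕ) : ℝ) := by exact_mod_cast hm
      linarith
    apply mul_left_cancel₀ h3
    simp only [Finset.card_singleton, Nat.cast_one] at h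
    push_cast at h h2 ⊢
    linear_combination ((n : ℝ) * 2) * ((n : ℝ) * 2 - 1) * h + ((n : ℝ) * 2 - m - 2 * 1) * h2

lemma prob_unseen_congr (i j : Fin n) (m : ℕ) : prob (Unseen {i} m) = prob (Unseen {j} m) := by
  have e : ∀ k : Fin n, prob (Unseen {k} m) = prob (Unseen {k} (min m (n * 2))) := by
    intro k
    congr 1; ext σ
    exact forall_congr' fun q => by rw [lt_min_iff]; simp
  rw [e i, e j]
  have hi := prob_unseen_singleton i (min_le_right m (n * 2))
  have hj := prob_unseen_singleton j (min_le_right m (n * 2))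
  have hn : (1 : ℝ) ≤ n := by exact_mod_cast Fin.pos i
  have h : (((n * 2 : ℕ) : ℝ) * ((n * 2 : ℕ) - 1)) ≠ 0 := by
    push_cast
    apply mul_ne_zero <;> linarith
  exact mul_left_cancel₀ h (hi.trans hj.symm)

/-- The events that two given secretaries do not arrive in the first `m` rounds are negatively
correlated. -/
lemma prob_unseen_pair_le {i j : Fin n} (hij : i ≠ j) (m : ℕ) (hm : m ≤ n * 2) :
    prob (Unseen {i, j} m) ≤ prob (Unseen {i} m) ^ 2 := by
  induction m with
  | zero => simp [prob_unseen_zero]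
  | succ m ih =>
    have h1 := prob_unseen_succ {i} (m := m) (by omega)
    have h2 := prob_unseen_succ {i, j} (m := m) (by omega)
    have h := ih (by omega)
    rw [Finset.card_pair hij] at h2
    rw [Finset.card_singleton] at h1
    set M : ℝ := ((n * 2 : ℕ) : ℝ) - m
    have hM : 0 < M := by
      have : (m : ℝ) < ((n * 2 : ℕ) : ℝ) := by exact_mod_cast hm
      simp only [M]; linarith
    push_cast at h1 h2
    have h0 := prob_nonneg (Unseen {i, j} m)
    have h3 : M ^ 2 * prob (Unseen {i, j} (m + 1)) ≤ M ^ 2 * prob (Unseen {i} (m + 1)) ^ 2 := by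
      have e1 : M ^ 2 * prob (Unseen {i, j} (m + 1)) = M * (M - 4) * prob (Unseen {i, j} m) := by
        linear_combination M * h2
      have e2 : M ^ 2 * prob (Unseen {i} (m + 1)) ^ 2 = (M - 2) ^ 2 * prob (Unseen {i} m) ^ 2 := by
        rw [← mul_pow, h1]; ring
      rw [e1, e2]
      calc M * (M - 4) * prob (Unseen {i, j} m) ≤ (M - 2) ^ 2 * prob (Unseen {i, j} m) := by
            gcongr; nlinarith
        _ ≤ _ := by gcongr
    exact le_of_mul_le_mul_left h3 (by positivity)

/-! ### Concentration of the number of secretaries seen -/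

/-- The probability that a given secretary does not arrive in the first `m` rounds, as the mean of
the proportion of such secretaries. -/
def unseenProb (n m : ℕ) : ℝ := avg (n := n) (unseenFrac m)

lemma Unseen.mono {T : Finset (Fin n)} {m m' : ℕ} (h : m ≤ m') {σ : ArrivalSeq n}
    (hσ : Unseen T m' σ) : Unseen T m σ := fun q hq => hσ q (hq.trans_le h)

lemma unseenFrac_anti {m m' : ℕ} (h : m ≤ m') (σ : ArrivalSeq n) :
    unseenFrac m' σ ≤ unseenFrac m σ := by
  unfold unseenFrac
  gcongr
  exact ind_mono fun hσ => hσ.mono h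

lemma unseenProb_eq (i : Fin n) (m : ℕ) : unseenProb n m = prob (Unseen {i} m) := by
  have hn : (n : ℝ) ≠ 0 := by exact_mod_cast (Fin.pos i).ne'
  unfold unseenProb unseenFrac
  have e : (fun σ : ArrivalSeq n => (∑ i : Fin n, ind (Unseen {i} m σ)) / n) =
      fun σ => (1 / (n : ℝ)) * ∑ i : Fin n, ind (Unseen {i} m σ) := by
    ext σ; ring
  have e2 : ∀ j ∈ Finset.univ, avg (fun σ => ind (Unseen {j} m σ)) = prob (Unseen {i} m) :=
    fun j _ => prob_unseen_congr j i m
  rw [e, avg_const_mul, avg_sum, Finset.sum_congr rfl e2]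
  simp only [Finset.sum_const, Finset.card_univ, Fintype.card_fin, nsmul_eq_mul]
  field_simp

lemma unseenProb_anti {m m' : ℕ} (h : m ≤ m') : unseenProb n m' ≤ unseenProb n m :=
  avg_mono (unseenFrac_anti h)

lemma unseenProb_formula (hn : 0 < n) {m : ℕ} (hm : m ≤ n * 2) :
    ((n * 2 : ℕ) : ℝ) * ((n * 2 : ℕ) - 1) * unseenProb n m =
      ((n * 2 : ℕ) - m) * ((n * 2 : ℕ) - m - 1) := by
  rw [unseenProb_eq ⟨0, hn⟩, prob_unseen_singleton _ hm]

lemma prob_eq_singleton (i : Fin n) (p : Fin (n * 2)) :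
    ((n * 2 : ℕ) : ℝ) * prob (fun σ => (σ p).1 = i) = 2 := by
  have h := prob_mem_of_roundInvariant (n := n) (m := 0) (A := fun _ => True)
    (fun _ _ _ _ _ h => h) {i} 0 (fun σ _ => by simp) p (Nat.zero_le _)
  have e : prob (fun _ : ArrivalSeq n => True) = 1 := by
    rw [← avg_const (n := n) 1]; unfold prob; congr 1; ext; exact ind_of_true trivial
  rw [e] at h
  simpa using h

lemma unseenProb_sub_succ_le (hn : 0 < n) (m : ℕ) :
    unseenProb n m - unseenProb n (m + 1) ≤ 2 / (n * 2 : ℕ) := by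
  have hn' : (0 : ℝ) < ((n * 2 : ℕ) : ℝ) := by exact_mod_cast (by omega)
  rw [unseenProb_eq ⟨0, hn⟩, unseenProb_eq ⟨0, hn⟩]
  by_cases hm : m < n * 2
  · have h1 := prob_and_add_prob_and_not (Unseen {(⟨0, hn⟩ : Fin n)} m)
      (fun σ => (σ ⟨m, hm⟩).1 ∈ ({⟨0, hn⟩} : Finset (Fin n)))
    have h2 : Unseen {(⟨0, hn⟩ : Fin n)} (m + 1) = fun σ =>
        Unseen {⟨0, hn⟩} m σ ∧ ¬ (σ ⟨m, hm⟩).1 ∈ ({⟨0, hn⟩} : Finset (Fin n)) := by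
      ext σ; exact unseen_succ_iff hm
    have h3 : prob (fun σ => Unseen {(⟨0, hn⟩ : Fin n)} m σ ∧
        (σ ⟨m, hm⟩).1 ∈ ({⟨0, hn⟩} : Finset (Fin n))) ≤
        prob (fun σ => (σ ⟨m, hm⟩).1 = (⟨0, hn⟩ : Fin n)) :=
      prob_mono fun σ h => Finset.mem_singleton.1 h.2
    have h4 := prob_eq_singleton (⟨0, hn⟩ : Fin n) ⟨m, hm⟩
    rw [h2, le_div_iff₀ hn']
    nlinarith
  · have : Unseen {(⟨0, hn⟩ : Fin n)} (m + 1) = Unseen {(⟨0, hn⟩ : Fin n)} m := by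
      ext σ
      exact forall_congr' fun q => by
        have := q.2
        simp only [show (q : ℕ) < m + 1 by omega, show (q : ℕ) < m by omega]
    rw [this, sub_self]
    positivity

lemma unseenProb_sub_le (hn : 0 < n) (m k : ℕ) :
    unseenProb n m - unseenProb n (m + k) ≤ 2 * k / (n * 2 : ℕ) := by
  induction k with
  | zero => simp
  | succ k ih =>
    have h := unseenProb_sub_succ_le hn (m + k)
    rw [← add_assoc]
    push_cast at h ih ⊢
    have e : 2 * ((k : ℝ) + 1) / (n * 2) = 2 * k / (n * 2) + 2 / (n * 2) := by ring
    linarith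

/-- The variance of `unseenFrac` is small, since different secretaries are negatively correlated. -/
lemma avg_sq_sub_le (hn : 0 < n) {m : ℕ} (hm : m ≤ n * 2) :
    avg (fun σ : ArrivalSeq n => (unseenFrac m σ - unseenProb n m) ^ 2) ≤ 1 / n := by
  have hn' : (0 : ℝ) < n := by exact_mod_cast hn
  have hpair : ∀ i j : Fin n, avg (fun σ => ind (Unseen {i} m σ) * ind (Unseen {j} m σ)) ≤
      unseenProb n m ^ 2 + if i = j then 1 else 0 := by
    intro i j
    by_cases hij : i = j
    · subst hij
      rw [if_pos rfl]
      have h1 : avg (fun σ => ind (Unseen {i} m σ) * ind (Unseen {i} m σ)) ≤ 1 := by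
        rw [← avg_const (n := n) 1]
        exact avg_mono fun σ => mul_le_one₀ (ind_le_one _) (ind_nonneg _) (ind_le_one _)
      nlinarith [sq_nonneg (unseenProb n m)]
    · rw [if_neg hij, add_zero, unseenProb_eq i]
      refine le_trans (le_of_eq ?_) (prob_unseen_pair_le hij m hm)
      unfold prob
      congr 1; ext σ
      rw [← ind_and]
      congr 1
      simp only [Unseen, Finset.mem_insert, Finset.mem_singleton, eq_iff_iff]
      constructor
      · rintro ⟨h1, h2⟩ q hq; have := h1 q hq; have := h2 q hq; tauto
      · exact fun h => ⟨fun q hq => by have := h q hq; tauto, fun q hq => by have := h q hq; tauto⟩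
  have e1 : ∀ σ : ArrivalSeq n, (unseenFrac m σ - unseenProb n m) ^ 2 =
      (1 / (n : ℝ) ^ 2) * (∑ i, ∑ j, ind (Unseen {i} m σ) * ind (Unseen {j} m σ)) -
        ((2 * unseenProb n m) * unseenFrac m σ - unseenProb n m ^ 2) := by
    intro σ
    rw [← Finset.sum_mul_sum]
    unfold unseenFrac
    field_simp
    ring
  have e2 : avg (fun σ : ArrivalSeq n => (unseenFrac m σ - unseenProb n m) ^ 2) =
      (1 / (n : ℝ) ^ 2) *
        (∑ i, ∑ j, avg fun σ : ArrivalSeq n => ind (Unseen {i} m σ) * ind (Unseen {j} m σ)) -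
        unseenProb n m ^ 2 := by
    simp only [e1]
    rw [avg_sub, avg_sub, avg_const, avg_const_mul, avg_const_mul, avg_sum]
    simp only [avg_sum]
    rw [show avg (fun σ : ArrivalSeq n => unseenFrac m σ) = unseenProb n m from rfl]
    ring
  have e3 : (∑ i, ∑ j, avg fun σ : ArrivalSeq n => ind (Unseen {i} m σ) * ind (Unseen {j} m σ)) ≤
      n * (n * unseenProb n m ^ 2 + 1) := by
    calc _ ≤ ∑ i : Fin n, ∑ j : Fin n, (unseenProb n m ^ 2 + if i = j then 1 else 0) := by
          gcongr; exact hpair _ _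
      _ = _ := by simp [Finset.sum_add_distrib]; ring
  rw [e2]
  have : (1 / (n : ℝ) ^ 2) * (n * (n * unseenProb n m ^ 2 + 1)) - unseenProb n m ^ 2 = 1 / n := by
    field_simp; ring
  rw [← this]
  gcongr

lemma avg_abs_sub_le (hn : 0 < n) {m : ℕ} (hm : m ≤ n * 2) :
    avg (fun σ : ArrivalSeq n => |unseenFrac m σ - unseenProb n m|) ≤ 1 / √n := by
  have hs : 0 < √(n : ℝ) := Real.sqrt_pos.2 (by exact_mod_cast hn)
  have hs2 : √(n : ℝ) * √n = n := Real.mul_self_sqrt (by positivity)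
  have h1 : ∀ σ : ArrivalSeq n, |unseenFrac m σ - unseenProb n m| ≤
      (√n / 2) * (unseenFrac m σ - unseenProb n m) ^ 2 + 1 / (2 * √n) := by
    intro σ
    set x := unseenFrac m σ - unseenProb n m
    have : 0 ≤ (√n * |x| - 1) ^ 2 / (2 * √n) := by positivity
    have e : (√n * |x| - 1) ^ 2 / (2 * √n) = (√n / 2) * |x| ^ 2 + 1 / (2 * √n) - |x| := by
      field_simp; ring
    rw [sq_abs] at e
    linarith
  calc _ ≤ _ := avg_mono h1
    _ = (√n / 2) * avg (fun σ : ArrivalSeq n => (unseenFrac m σ - unseenProb n m) ^ 2) +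
        1 / (2 * √n) := by rw [avg_add, avg_const_mul, avg_const]
    _ ≤ (√n / 2) * (1 / n) + 1 / (2 * √n) := by
        gcongr; exact avg_sq_sub_le hn hm
    _ = 1 / √n := by
        rw [show 1 / (n : ℝ) = 1 / √n * (1 / √n) by rw [div_mul_div_comm, hs2, one_mul]]
        field_simp; norm_num

/-- The deviations of `unseenFrac` from its mean on a grid of `J + 2` rounds. -/
def gridDev (J : ℕ) (σ : ArrivalSeq n) : ℝ :=
  ∑ j ∈ Finset.range (J + 2),
    |unseenFrac (j * (n * 2 / (J + 1) + 1)) σ - unseenProb n (j * (n * 2 / (J + 1) + 1))|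

/-- By monotonicity, the deviations on a grid control all deviations. -/
lemma abs_sub_le_gridDev (hn : 0 < n) (J : ℕ) {m : ℕ} (hm : m ≤ n * 2) (σ : ArrivalSeq n) :
    |unseenFrac m σ - unseenProb n m| ≤ gridDev J σ + (2 / (J + 1) + 1 / n) := by
  have hn' : (0 : ℝ) < n := by exact_mod_cast hn
  set B := n * 2 / (J + 1) + 1 with hB
  have hBpos : 0 < B := Nat.succ_pos _
  have hjJ : m / B < J + 1 := by
    rw [Nat.div_lt_iff_lt_mul hBpos]
    exact hm.trans_lt (Nat.lt_mul_div_succ (n * 2) (Nat.succ_pos J))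
  set j := m / B with hj
  have h1 : j * B ≤ m := Nat.div_mul_le_self m B
  have h2 : m ≤ (j + 1) * B := (Nat.lt_mul_of_div_lt (Nat.lt_succ_self _) hBpos).le
  have hg : ∀ k < J + 2, |unseenFrac (k * B) σ - unseenProb n (k * B)| ≤ gridDev J σ := by
    intro k hk
    exact Finset.single_le_sum
      (f := fun k => |unseenFrac (k * B) σ - unseenProb n (k * B)|)
      (fun _ _ => abs_nonneg _) (Finset.mem_range.2 hk)
  have g1 := abs_le.1 (hg j (by omega))
  have g2 := abs_le.1 (hg (j + 1) (by omega))
  have u1 := unseenFrac_anti h1 σ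
  have u2 := unseenFrac_anti h2 σ
  have v1 := unseenProb_anti (n := n) h1
  have v2 := unseenProb_anti (n := n) h2
  have l := unseenProb_sub_le hn (j * B) B
  rw [show j * B + B = (j + 1) * B by ring] at l
  have hb : 2 * (B : ℝ) / (n * 2 : ℕ) ≤ 2 / (J + 1) + 1 / n := by
    have : ((n * 2 / (J + 1) : ℕ) : ℝ) ≤ ((n * 2 : ℕ) : ℝ) / ((J + 1 : ℕ) : ℝ) := Nat.cast_div_le
    rw [hB]
    push_cast at this ⊢
    rw [div_le_iff₀ (by positivity)]
    have e : (2 / ((J : ℝ) + 1) + 1 / n) * (n * 2) = 2 * (n * 2 / (J + 1)) + 2 := by field_simp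
    rw [e]; linarith
  rw [abs_le]
  constructor <;> linarith [g1.1, g1.2, g2.1, g2.2]

lemma avg_gridDev_le (hn : 0 < n) (J : ℕ) :
    avg (fun σ : ArrivalSeq n => gridDev J σ) ≤ (J + 2) / √n := by
  unfold gridDev
  rw [avg_sum]
  have key : ∀ m : ℕ, avg (fun σ : ArrivalSeq n => |unseenFrac m σ - unseenProb n m|) ≤ 1 / √n := by
    intro m
    have e : ∀ σ : ArrivalSeq n, unseenFrac m σ = unseenFrac (min m (n * 2)) σ := by
      intro σ
      unfold unseenFrac
      congr 2; ext i; congr 1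
      exact propext (forall_congr' fun q => by rw [lt_min_iff]; simp)
    have e2 : unseenProb n m = unseenProb n (min m (n * 2)) := by
      unfold unseenProb; congr 1; ext σ; exact e σ
    rw [e2]
    simp only [e]
    exact avg_abs_sub_le hn (min_le_right _ _)
  calc _ ≤ ∑ j ∈ Finset.range (J + 2), 1 / √(n : ℝ) := Finset.sum_le_sum fun j _ => key _
    _ = _ := by simp; ring

/-! ### Symmetry of the labels -/

/-- The event `A` is determined by the relative order of the secretaries of the first `m`
rounds. -/
def Adapted (m : ℕ) (A : ArrivalSeq n → Prop) : Prop :=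
  ∀ σ σ' : ArrivalSeq n, (∀ q q' : Fin (n * 2), (q : ℕ) < m → (q' : ℕ) < m →
    ((σ q).1 ≤ (σ q').1 ↔ (σ' q).1 ≤ (σ' q').1)) → A σ → A σ'

lemma Adapted.roundInvariant {m : ℕ} {A : ArrivalSeq n → Prop} (hA : Adapted m A) :
    RoundInvariant m A := by
  intro p q hp hq σ h
  refine hA σ _ (fun r r' hr hr' => ?_) h
  have e : ∀ r : Fin (n * 2), (r : ℕ) < m → Equiv.swap p q r = r := by
    intro r hr
    apply Equiv.swap_apply_of_ne_of_ne <;> (rintro rfl; omega)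
  rw [Equiv.trans_apply, Equiv.trans_apply, e r hr, e r' hr']

lemma cycleRange_le_cycleRange_iff {v i j : Fin n} (hi : i ≠ v) (hj : j ≠ v) :
    v.cycleRange i ≤ v.cycleRange j ↔ i ≤ j := by
  cases n with
  | zero => exact i.elim0
  | succ k =>
    obtain ⟨i', rfl⟩ := Fin.exists_succAbove_eq hi
    obtain ⟨j', rfl⟩ := Fin.exists_succAbove_eq hj
    simp [Fin.cycleRange_succAbove]

lemma cycleRange_eq_iff {v i₀ i : Fin n} (h : ∀ j, i₀ ≤ j) : v.cycleRange i = i₀ ↔ i = v := by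
  cases n with
  | zero => exact i.elim0
  | succ k =>
    have : i₀ = 0 := le_antisymm (h 0) (Fin.zero_le _)
    rw [this, ← Fin.cycleRange_self v, (Fin.cycleRange v).injective.eq_iff]

/-- The proportion of secretaries not yet seen is the conditional probability, given the relative
order seen so far, that the best secretary is not yet seen. -/
lemma prob_and_unseen {i₀ : Fin n} (h₀ : ∀ j, i₀ ≤ j) {m : ℕ} {A : ArrivalSeq n → Prop}
    (hA : Adapted m A) :
    prob (fun σ => A σ ∧ Unseen {i₀} m σ) = avg fun σ => ind (A σ) * unseenFrac m σ := by
  have hn : (0 : ℝ) < n := by exact_mod_cast Fin.pos i₀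
  -- the label `v` becomes `i₀`, and the order of the other labels is not changed
  have key : ∀ v : Fin n, prob (fun σ => A σ ∧ Unseen {v} m σ) =
      prob (fun σ => A σ ∧ Unseen {i₀} m σ) := by
    intro v
    unfold prob
    rw [← avg_comp (Equiv.equivCongr (Equiv.refl _) (v.cycleRange.prodCongr (Equiv.refl _)))
      (fun σ => ind (A σ ∧ Unseen {i₀} m σ))]
    congr 1; ext σ; congr 1
    set σ' := Equiv.equivCongr (Equiv.refl _) (v.cycleRange.prodCongr (Equiv.refl _)) σ with hσ'
    have e : ∀ q, (σ' q).1 = v.cycleRange (σ q).1 := fun q => by simp [hσ']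
    have hu : Unseen {i₀} m σ' ↔ Unseen {v} m σ :=
      forall_congr' fun q => by
        simp only [Finset.mem_singleton, e, cycleRange_eq_iff h₀]
    rw [eq_iff_iff, hu, and_congr_left_iff]
    intro hv
    have ho : ∀ q q' : Fin (n * 2), (q : ℕ) < m → (q' : ℕ) < m →
        ((σ q).1 ≤ (σ q').1 ↔ (σ' q).1 ≤ (σ' q').1) := by
      intro q q' hq hq'
      rw [e, e, cycleRange_le_cycleRange_iff]
      · simpa using hv q hq
      · simpa using hv q' hq'
    exact ⟨hA σ σ' ho, hA σ' σ fun q q' hq hq' => (ho q q' hq hq').symm⟩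
  have h2 : (fun σ => ind (A σ) * unseenFrac m σ) = fun σ : ArrivalSeq n =>
      (1 / (n : ℝ)) * ∑ v : Fin n, ind (A σ ∧ Unseen {v} m σ) := by
    ext σ
    unfold unseenFrac
    simp only [ind_and, ← Finset.mul_sum]
    ring
  rw [h2, avg_const_mul, avg_sum]
  have h3 : ∀ v ∈ Finset.univ, avg (fun σ => ind (A σ ∧ Unseen {v} m σ)) =
      prob (fun σ => A σ ∧ Unseen {i₀} m σ) := fun v _ => key v
  rw [Finset.sum_congr rfl h3]
  simp only [Finset.sum_const, Finset.card_univ, Fintype.card_fin, nsmul_eq_mul]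
  field_simp

/-! ### The linear program satisfied by a strategy -/

/-- The part of a stopping rule that matters for its winning probability.  `rejects a` says that
nobody is accepted before round `a`, and `claims r` says that round `r` is the second visit of the
best secretary seen so far and that he has been accepted in this round or earlier.  Both depend on
the relative order observed only; `i₀` is the best secretary. -/
structure StoppingData (n : ℕ) (i₀ : Fin n) where
  rejects : ℕ → ArrivalSeq n → Prop
  claims : Fin (n * 2) → ArrivalSeq n → Prop
  adapted_rejects : ∀ a, Adapted a (rejects a)
  adapted_claims : ∀ r : Fin (n * 2), Adapted (r + 1) (claims r)
  disjoint : ∀ a σ, ind (rejects a σ) +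
    ∑ r ∈ Finset.univ.filter (fun r : Fin (n * 2) => (r : ℕ) < a), ind (claims r σ) ≤ 1
  best : ∀ r σ, claims r σ → ∀ q ≤ r, (σ r).1 ≤ (σ q).1
  first_visit : ∀ r σ, claims r σ → (σ r).1 = i₀ →
    ∃ a < r, rejects a σ ∧ Unseen {i₀} a σ ∧ (σ a).1 = i₀

namespace StoppingData

variable {i₀ : Fin n} (S : StoppingData n i₀)

/-- The probability of winning in the round `r` of the second visit of the best secretary. -/
def winAt (r : Fin (n * 2)) : ℝ := prob fun σ => S.claims r σ ∧ (σ r).1 = i₀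

lemma winAt_eq (h₀ : ∀ j, i₀ ≤ j) (r : Fin (n * 2)) :
    S.winAt r = avg fun σ => ind (S.claims r σ) * (1 - unseenFrac (r + 1) σ) := by
  have h1 := prob_and_add_prob_and_not (S.claims r) (Unseen {i₀} (r + 1))
  rw [prob_and_unseen h₀ (S.adapted_claims r)] at h1
  have h2 : S.winAt r = prob fun σ => S.claims r σ ∧ ¬ Unseen {i₀} (r + 1) σ := by
    unfold winAt
    congr 1; ext σ
    rw [and_congr_right_iff]
    intro hσ
    constructor
    · exact fun h hu => hu r (Nat.lt_succ_self _) (by simpa using h)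
    · intro h
      unfold Unseen at h
      push Not at h
      obtain ⟨q, hq, hq'⟩ := h
      have := S.best r σ hσ q (Fin.le_def.2 (by omega))
      rw [Finset.mem_singleton.1 hq'] at this
      exact le_antisymm this (h₀ _)
  simp only [mul_sub, mul_one]
  rw [avg_sub, h2]
  unfold prob at *
  linarith

/-- A best-so-far secretary is the best of all with a conditional probability close to the
probability that a given secretary has been seen. -/
lemma winAt_le_add (h₀ : ∀ j, i₀ ≤ j) (r : Fin (n * 2)) :
    S.winAt r ≤ (1 - unseenProb n (r + 1)) * prob (S.claims r) +
      avg fun σ => ind (S.claims r σ) * |unseenFrac (r + 1) σ - unseenProb n (r + 1)| := by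
  rw [S.winAt_eq h₀]
  unfold prob
  rw [← avg_const_mul, ← avg_add]
  apply avg_mono
  intro σ
  have h := neg_abs_le (unseenFrac (r + 1) σ - unseenProb n (r + 1))
  have h2 := ind_nonneg (S.claims r σ)
  nlinarith

/-- Given that the best secretary has not arrived before round `a`, his two visits are uniformly
distributed over the pairs of remaining rounds. -/
lemma prob_visits (h₀ : ∀ j, i₀ ≤ j) {a r : Fin (n * 2)} (har : a < r) :
    ((n * 2 : ℕ) - a) * ((n * 2 : ℕ) - a - 1) * prob (fun σ =>
      ((S.rejects a σ ∧ Unseen {i₀} a σ) ∧ (σ a).1 ∈ ({i₀} : Finset (Fin n))) ∧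
        (σ r).1 ∈ ({i₀} : Finset (Fin n))) =
      2 * avg fun σ => ind (S.rejects a σ) * unseenFrac a σ := by
  have hA := (S.adapted_rejects a).roundInvariant.and (roundInvariant_unseen {i₀} a)
  have h1 := prob_mem_of_roundInvariant hA {i₀} 0 (fun σ h => h.2.sum_eq_zero) a le_rfl
  have hB : RoundInvariant (a + 1) (fun σ : ArrivalSeq n =>
      (S.rejects a σ ∧ Unseen {i₀} a σ) ∧ (σ a).1 ∈ ({i₀} : Finset (Fin n))) := by
    refine (hA.mono (Nat.le_succ _)).and ?_
    intro p q hp hq σ h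
    rwa [Equiv.trans_apply, Equiv.swap_apply_of_ne_of_ne] <;> (rintro rfl; omega)
  have h2 := prob_mem_of_roundInvariant hB {i₀} 1 (fun σ h => by
    have e : Finset.univ.filter (fun p : Fin (n * 2) => (p : ℕ) < a + 1) =
        insert a (Finset.univ.filter (fun p : Fin (n * 2) => (p : ℕ) < a)) := by
      ext p; simp [Fin.ext_iff]; omega
    rw [e, Finset.sum_insert (by simp), h.1.2.sum_eq_zero, ind_of_true h.2, add_zero]) r
    (by exact har)
  rw [prob_and_unseen h₀ (S.adapted_rejects a)] at h1
  simp only [Finset.card_singleton] at h1 h2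
  push_cast at h1 h2 ⊢
  linear_combination ((n : ℝ) * 2 - a) * h2 + h1

/-- To win in round `r`, the best secretary must have his first visit in an earlier round `a` before
which nobody is accepted. -/
lemma winAt_le_sum (h₀ : ∀ j, i₀ ≤ j) (r : Fin (n * 2)) :
    S.winAt r ≤ ∑ a ∈ Finset.range r,
      (2 / ((n * 2 : ℕ) * ((n * 2 : ℕ) - 1)) * prob (S.rejects a) +
        2 / (((n * 2 : ℕ) - a) * ((n * 2 : ℕ) - a - 1)) * (1 / √n)) := by
  have hn : 0 < n := Fin.pos i₀
  have hterm : ∀ a ∈ Finset.range r, prob (fun σ => S.rejects a σ ∧ Unseen {i₀} a σ ∧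
      ∃ ha : a < n * 2, (σ ⟨a, ha⟩).1 = i₀ ∧ (σ r).1 = i₀) ≤
      2 / ((n * 2 : ℕ) * ((n * 2 : ℕ) - 1)) * prob (S.rejects a) +
        2 / (((n * 2 : ℕ) - a) * ((n * 2 : ℕ) - a - 1)) * (1 / √n) := by
    intro a ha
    rw [Finset.mem_range] at ha
    have ha2 : a < n * 2 := ha.trans r.2
    have h := S.prob_visits h₀ (a := ⟨a, ha2⟩) (r := r) ha
    have e : (fun σ => S.rejects a σ ∧ Unseen {i₀} a σ ∧
        ∃ ha : a < n * 2, (σ ⟨a, ha⟩).1 = i₀ ∧ (σ r).1 = i₀) = (fun σ : ArrivalSeq n =>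
      ((S.rejects a σ ∧ Unseen {i₀} a σ) ∧ (σ ⟨a, ha2⟩).1 ∈ ({i₀} : Finset (Fin n))) ∧
        (σ r).1 ∈ ({i₀} : Finset (Fin n))) := by
      ext σ
      simp only [Finset.mem_singleton, ha2, exists_true_left]
      tauto
    rw [e]
    have hu := unseenProb_formula hn ha2.le
    have hd := avg_abs_sub_le hn ha2.le
    have hle : avg (fun σ => ind (S.rejects a σ) * unseenFrac a σ) ≤
        unseenProb n a * prob (S.rejects a) + 1 / √n := by
      refine le_trans ?_ (add_le_add_right hd _)
      unfold prob
      rw [← avg_const_mul, ← avg_add]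
      apply avg_mono
      intro σ
      have h1 := le_abs_self (unseenFrac a σ - unseenProb n a)
      have h2 := ind_nonneg (S.rejects a σ)
      have h3 := ind_le_one (S.rejects a σ)
      have h4 := abs_nonneg (unseenFrac a σ - unseenProb n a)
      nlinarith
    have hr : ((a : ℝ) + 1) + 1 ≤ ((n * 2 : ℕ) : ℝ) := by
      have := r.2
      exact_mod_cast (by omega : a + 1 + 1 ≤ n * 2)
    have ha0 : (0 : ℝ) ≤ a := by positivity
    set N : ℝ := ((n * 2 : ℕ) : ℝ)
    have p1 : 0 < N - a := by linarith
    have p2 : 0 < N - a - 1 := by linarith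
    have p3 : 0 < N := by linarith
    have p4 : 0 < N - 1 := by linarith
    have hu' : unseenProb n a = (N - a) * (N - a - 1) / (N * (N - 1)) := by
      field_simp
      linear_combination hu
    have h' : prob (fun σ : ArrivalSeq n =>
      ((S.rejects a σ ∧ Unseen {i₀} a σ) ∧ (σ ⟨a, ha2⟩).1 ∈ ({i₀} : Finset (Fin n))) ∧
        (σ r).1 ∈ ({i₀} : Finset (Fin n))) = 2 / ((N - a) * (N - a - 1)) *
          avg fun σ => ind (S.rejects a σ) * unseenFrac a σ := by
      have p5 : (N - a) * (N - a - 1) ≠ 0 := by positivity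
      apply mul_left_cancel₀ p5
      rw [h]
      field_simp
    rw [h']
    calc _ ≤ 2 / ((N - a) * (N - a - 1)) * (unseenProb n a * prob (S.rejects a) + 1 / √n) := by
          gcongr
      _ = _ := by
        rw [mul_add, hu']
        field_simp
  refine le_trans ?_ (Finset.sum_le_sum hterm)
  unfold winAt prob
  rw [← avg_sum]
  apply avg_mono
  intro σ
  by_cases h : S.claims r σ ∧ (σ r).1 = i₀
  · obtain ⟨a, har, h1, h2, h3⟩ := S.first_visit r σ h.1 h.2
    refine (ind_le_one _).trans ?_
    rw [← ind_of_true (p := S.rejects a σ ∧ Unseen {i₀} a σ ∧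
      ∃ ha : (a : ℕ) < n * 2, (σ ⟨a, ha⟩).1 = i₀ ∧ (σ r).1 = i₀) ⟨h1, h2, a.2, h3, h.2⟩]
    exact Finset.single_le_sum (f := fun a : ℕ => ind (S.rejects a σ ∧ Unseen {i₀} a σ ∧
      ∃ ha : (a : ℕ) < n * 2, (σ ⟨a, ha⟩).1 = i₀ ∧ (σ r).1 = i₀))
      (fun _ _ => ind_nonneg _) (Finset.mem_range.2 har)
  · rw [ind_of_false h]
    exact Finset.sum_nonneg fun _ _ => ind_nonneg _

lemma prob_rejects_le (a : ℕ) : prob (S.rejects a) ≤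
    1 - ∑ r ∈ Finset.univ.filter (fun r : Fin (n * 2) => (r : ℕ) < a), prob (S.claims r) := by
  have : prob (S.rejects a) +
      ∑ r ∈ Finset.univ.filter (fun r : Fin (n * 2) => (r : ℕ) < a), prob (S.claims r) ≤ 1 := by
    unfold prob
    rw [← avg_sum, ← avg_add, ← avg_const (n := n) 1]
    exact avg_mono (S.disjoint a)
  linarith

lemma sum_claims_le (σ : ArrivalSeq n) : ∑ r, ind (S.claims r σ) ≤ 1 := by
  have h := S.disjoint (n * 2) σ
  rw [Finset.filter_true_of_mem fun r _ => r.2] at h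
  linarith [ind_nonneg (S.rejects (n * 2) σ)]

lemma sum_prob_claims_le : ∑ r, prob (S.claims r) ≤ 1 := by
  unfold prob
  rw [← avg_sum, ← avg_const (n := n) 1]
  exact avg_mono S.sum_claims_le

end StoppingData

lemma sum_telescope {N : ℕ} {r : ℕ} (hr : r < N) :
    ∑ a ∈ Finset.range r, 2 / (((N : ℝ) - a) * (N - a - 1)) ≤ 2 / ((N : ℝ) - r) := by
  have : ∑ a ∈ Finset.range r, 2 / (((N : ℝ) - a) * (N - a - 1)) =
      2 / ((N : ℝ) - r) - 2 / N := by
    induction r with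
    | zero => simp
    | succ r ih =>
      rw [Finset.sum_range_succ, ih (by omega)]
      have h : ((r : ℝ) + 1) + 1 ≤ N := by exact_mod_cast hr
      have h1 : (N : ℝ) - r ≠ 0 := by linarith
      have h2 : (N : ℝ) - r - 1 ≠ 0 := by linarith
      have h3 : (N : ℝ) - ((r + 1 : ℕ) : ℝ) ≠ 0 := by push_cast; linarith
      push_cast at h3 ⊢
      have e : (N : ℝ) - (r + 1) = N - r - 1 := by ring
      rw [e]
      field_simp
      ring
  rw [this]
  have : (0 : ℝ) ≤ 2 / N := by positivity
  linarith

lemma sum_inv_le (N : ℕ) : ∑ r : Fin N, 2 / ((N : ℝ) - (r : ℕ)) ≤ 2 * (1 + Real.log N) := by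
  have h := harmonic_le_one_add_log N
  rw [Fin.sum_univ_eq_sum_range (fun r => 2 / ((N : ℝ) - r)),
    ← Finset.sum_range_reflect]
  refine le_trans (le_of_eq ?_) (mul_le_mul_of_nonneg_left h zero_le_two)
  rw [harmonic]
  push_cast
  rw [Finset.mul_sum]
  refine Finset.sum_congr rfl fun r hr => ?_
  rw [Finset.mem_range] at hr
  rw [Nat.cast_sub (by omega), Nat.cast_sub (by omega)]
  push_cast
  rw [div_eq_mul_inv]
  congr 2
  ring

/-! ### The dual bound -/

/-- The error of the dual bound for `n` secretaries, when deviations are controlled on a grid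
of `J + 2` rounds. -/
def dualError (n J : ℕ) : ℝ :=
  7 / ((n * 2 : ℕ) - 1) + (J + 2) / √n + (2 / (J + 1) + 1 / n) +
    2 * (1 + Real.log (n * 2 : ℕ)) * (1 / √n)

/-- The dual weight of a round. -/
def roundWeight (μ : ℝ) (r : Fin (n * 2)) : ℝ := dualWeight μ ((r : ℕ) / (n * 2 : ℕ))

lemma div_mem_Icc (r : Fin (n * 2)) : ((r : ℕ) : ℝ) / (n * 2 : ℕ) ∈ Set.Icc (0 : ℝ) 1 := by
  have h : ((r : ℕ) : ℝ) < (n * 2 : ℕ) := by exact_mod_cast r.2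
  have h0 : (0 : ℝ) ≤ (r : ℕ) := by positivity
  exact ⟨by positivity, (div_le_one (by linarith)).2 h.le⟩

lemma roundWeight_mem {μ : ℝ} (hμ0 : 0 < μ) (hμ1 : μ < 1) (hμ : rejectRatio μ = 1 / 2)
    (r : Fin (n * 2)) : roundWeight μ r ∈ Set.Icc (0 : ℝ) 1 :=
  dualWeight_mem hμ0 hμ1 hμ (div_mem_Icc r)

lemma roundWeight_mul_max (μ : ℝ) (ρ r : Fin (n * 2)) :
    roundWeight μ r * max (((r : ℕ) : ℝ) - (ρ : ℕ)) 0 =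
      (n * 2 : ℕ) * dualTail μ ((ρ : ℕ) / (n * 2 : ℕ)) ((r : ℕ) / (n * 2 : ℕ)) := by
  have hN : (0 : ℝ) < (n * 2 : ℕ) := by
    have := r.2
    exact_mod_cast (by omega : 0 < n * 2)
  have e : ((r : ℕ) : ℝ) / (n * 2 : ℕ) - (ρ : ℕ) / (n * 2 : ℕ) =
      (((r : ℕ) : ℝ) - (ρ : ℕ)) / (n * 2 : ℕ) := by ring
  have e2 : max ((((r : ℕ) : ℝ) - (ρ : ℕ)) / (n * 2 : ℕ)) 0 =
      max (((r : ℕ) : ℝ) - (ρ : ℕ)) 0 / (n * 2 : ℕ) := by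
    rw [← zero_div ((n * 2 : ℕ) : ℝ), max_div_div_right hN.le, zero_div]
  rw [dualTail, e, e2, roundWeight]
  field_simp

lemma dual_objective_le (hn : 0 < n) {μ : ℝ} (hμ0 : 0 < μ) (hμ1 : μ < 1)
    (hμ : rejectRatio μ = 1 / 2) :
    2 / ((n * 2 : ℕ) * (((n * 2 : ℕ) : ℝ) - 1)) *
        ∑ r : Fin (n * 2), roundWeight μ r * (r : ℕ) ≤
      (n * 2 : ℕ) / ((n * 2 : ℕ) - 1) * limitProb μ := by
  have h := (sum_range_le_integral (monotoneOn_dualTail hμ0 hμ1 hμ 0) (by omega : 0 < n * 2)).1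
  rw [← Fin.sum_univ_eq_sum_range (fun r => dualTail μ 0 ((r : ℝ) / (n * 2 : ℕ)))] at h
  have e : ∑ r : Fin (n * 2), roundWeight μ r * (r : ℕ) =
      (n * 2 : ℕ) * ∑ r : Fin (n * 2), dualTail μ 0 ((r : ℕ) / (n * 2 : ℕ)) := by
    rw [Finset.mul_sum]
    refine Finset.sum_congr rfl fun r _ => ?_
    have h0 := roundWeight_mul_max μ ⟨0, by omega⟩ r
    simpa using h0
  have hN2 : 2 ≤ ((n * 2 : ℕ) : ℝ) := by exact_mod_cast (by omega : 2 ≤ n * 2)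
  rw [e, ← two_mul_integral_dualTail_zero hμ0 hμ1 hμ]
  generalize ((n * 2 : ℕ) : ℝ) = N at *
  have hN1 : 0 < N - 1 := by linarith
  have hN0 : 0 < N := by linarith
  calc _ ≤ 2 / (N * (N - 1)) * (N * (N * ∫ t in (0:ℝ)..1, dualTail μ 0 t)) := by gcongr
    _ = _ := by field_simp

lemma one_sub_unseenProb_le (hn : 0 < n) (ρ : Fin (n * 2)) :
    1 - unseenProb n (ρ + 1) ≤ seenProb ((ρ : ℕ) / (n * 2 : ℕ)) + 3 / ((n * 2 : ℕ) - 1) := by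
  have hN2 : 2 ≤ ((n * 2 : ℕ) : ℝ) := by exact_mod_cast (by omega : 2 ≤ n * 2)
  have hs01 := div_mem_Icc ρ
  have hu := unseenProb_formula hn (m := (ρ : ℕ) + 1) (by omega)
  have hpos : 0 ≤ (((n * 2 : ℕ) : ℝ) - ((ρ : ℕ) : ℝ) - 1) * ((n * 2 : ℕ) - (ρ : ℕ) - 2) := by
    rcases Nat.lt_or_ge ((ρ : ℕ) + 1) (n * 2) with h | h
    · have : ((ρ : ℕ) : ℝ) + 1 + 1 ≤ ((n * 2 : ℕ) : ℝ) := by exact_mod_cast h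
      apply mul_nonneg <;> linarith
    · have : ((ρ : ℕ) : ℝ) + 1 = ((n * 2 : ℕ) : ℝ) := by
        have := ρ.2
        exact_mod_cast (by omega : (ρ : ℕ) + 1 = n * 2)
      rw [← this]; simp
  generalize hU : unseenProb n (ρ + 1) = U at *
  rw [Nat.cast_add] at hu
  generalize ((n * 2 : ℕ) : ℝ) = N at *
  generalize ((ρ : ℕ) : ℝ) = x at *
  have hN1 : 0 < N - 1 := by linarith
  have hN0 : 0 < N := by linarith
  have hu' : U = (N - x - 1) * (N - x - 2) / (N * (N - 1)) := by
    have : N * (N - 1) ≠ 0 := by positivity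
    rw [eq_div_iff this]
    push_cast at hu
    linear_combination hu
  have hle : (N - x - 1) * (N - x - 2) / (N * N) ≤ U := by
    rw [hu']
    gcongr
    linarith
  have e3 : (N - x - 1) * (N - x - 2) / (N * N) =
      (1 - x / N) ^ 2 - 3 * (1 - x / N) / N + 2 / (N * N) := by
    field_simp; ring
  have e4 : 3 * (1 - x / N) / N ≤ 3 / (N - 1) := by
    gcongr
    · linarith [hs01.1]
    · linarith
  have e5 : 0 ≤ 2 / (N * N) := by positivity
  unfold seenProb
  nlinarith

/-- The discretized dual weights are feasible up to an error of order `1 / n`. -/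
lemma roundWeight_feasible (hn : 0 < n) {μ : ℝ} (hμ0 : 0 < μ) (hμ1 : μ < 1)
    (hμ : rejectRatio μ = 1 / 2) (ρ : Fin (n * 2)) :
    (1 - roundWeight μ ρ) * (1 - unseenProb n (ρ + 1)) -
      2 / ((n * 2 : ℕ) * (((n * 2 : ℕ) : ℝ) - 1)) *
        ∑ r : Fin (n * 2), roundWeight μ r * (max (((r : ℕ) : ℝ) - (ρ : ℕ)) 0 - 1) ≤
      7 / ((n * 2 : ℕ) - 1) := by
  have hN2 : 2 ≤ ((n * 2 : ℕ) : ℝ) := by exact_mod_cast (by omega : 2 ≤ n * 2)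
  have hs01 := div_mem_Icc ρ
  have hw1 := roundWeight_mem hμ0 hμ1 hμ ρ
  have hD := one_sub_unseenProb_le hn ρ
  have hI := dualWeight_feasible hμ0 hμ1 hμ hs01.2
  have h := (sum_range_le_integral (monotoneOn_dualTail hμ0 hμ1 hμ ((ρ : ℕ) / (n * 2 : ℕ)))
    (by omega : 0 < n * 2)).2
  rw [← Fin.sum_univ_eq_sum_range
    (fun r => dualTail μ ((ρ : ℕ) / (n * 2 : ℕ)) ((r : ℝ) / (n * 2 : ℕ)))] at h
  have hend : dualTail μ ((ρ : ℕ) / (n * 2 : ℕ)) 1 - dualTail μ ((ρ : ℕ) / (n * 2 : ℕ)) 0 ≤ 1 := by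
    unfold dualTail
    rw [dualWeight_one hμ1, dualWeight_zero hμ0, max_eq_left (by linarith [hs01.2])]
    linarith [hs01.1]
  have hwsum : ∑ r : Fin (n * 2), roundWeight μ r ≤ (n * 2 : ℕ) := by
    calc _ ≤ ∑ r : Fin (n * 2), (1 : ℝ) :=
          Finset.sum_le_sum fun r _ => (roundWeight_mem hμ0 hμ1 hμ r).2
      _ = (n * 2 : ℕ) := by simp
  have e : ∑ r : Fin (n * 2), roundWeight μ r * (max (((r : ℕ) : ℝ) - (ρ : ℕ)) 0 - 1) =
      (n * 2 : ℕ) * ∑ r : Fin (n * 2), dualTail μ ((ρ : ℕ) / (n * 2 : ℕ)) ((r : ℕ) / (n * 2 : ℕ))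
        - ∑ r : Fin (n * 2), roundWeight μ r := by
    rw [Finset.mul_sum, ← Finset.sum_sub_distrib]
    refine Finset.sum_congr rfl fun r _ => ?_
    rw [← roundWeight_mul_max μ ρ r]; ring
  rw [e]
  have hD0 : 0 ≤ seenProb (((ρ : ℕ) : ℝ) / (n * 2 : ℕ)) := by
    unfold seenProb; nlinarith [hs01.1, hs01.2]
  have hwI : (1 - roundWeight μ ρ) * seenProb (((ρ : ℕ) : ℝ) / (n * 2 : ℕ)) ≤
      2 * ∫ t in (0:ℝ)..1, dualTail μ ((ρ : ℕ) / (n * 2 : ℕ)) t := hI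
  clear hI e
  generalize (∑ r : Fin (n * 2), dualTail μ ((ρ : ℕ) / (n * 2 : ℕ)) ((r : ℕ) / (n * 2 : ℕ))) = A at *
  generalize (∑ r : Fin (n * 2), roundWeight μ r) = W at *
  generalize (∫ t in (0:ℝ)..1, dualTail μ ((ρ : ℕ) / (n * 2 : ℕ)) t) = I at *
  generalize seenProb (((ρ : ℕ) : ℝ) / (n * 2 : ℕ)) = d at *
  generalize roundWeight μ ρ = w at *
  generalize unseenProb n (ρ + 1) = U at *
  generalize ((n * 2 : ℕ) : ℝ) = N at *
  have hN1 : 0 < N - 1 := by linarith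
  have hN0 : 0 < N := by linarith
  have hI0 : 0 ≤ 2 * I := le_trans (mul_nonneg (by linarith [hw1.2]) hD0) hwI
  have hlow : 2 * I - 4 / (N - 1) ≤ 2 / (N * (N - 1)) * (N * A - W) := by
    calc 2 * I - 4 / (N - 1) ≤ N / (N - 1) * (2 * I) - 4 / (N - 1) := by
          have : 1 ≤ N / (N - 1) := by rw [le_div_iff₀ hN1]; linarith
          nlinarith
      _ = 2 / (N * (N - 1)) * (N * (N * I - 1) - N) := by field_simp; ring
      _ ≤ _ := by gcongr; linarith
  have h3N : 0 ≤ 3 / (N - 1) := by positivity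
  calc _ ≤ (1 - w) * (d + 3 / (N - 1)) - (2 * I - 4 / (N - 1)) := by
        gcongr
        linarith [hw1.2]
    _ ≤ 3 / (N - 1) + 4 / (N - 1) := by nlinarith [hw1.1]
    _ = _ := by ring

namespace StoppingData

variable {i₀ : Fin n} (S : StoppingData n i₀) {μ : ℝ}

/-- The first way to bound the winning probability, by the claims alone. -/
lemma sum_one_sub_mul_winAt_le (h₀ : ∀ j, i₀ ≤ j) (J : ℕ) {w : Fin (n * 2) → ℝ}
    (hw : ∀ r, w r ∈ Set.Icc (0 : ℝ) 1) :
    ∑ r, (1 - w r) * S.winAt r ≤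
      ∑ r, (1 - w r) * ((1 - unseenProb n (r + 1)) * prob (S.claims r)) +
        ((J + 2) / √n + (2 / (J + 1) + 1 / n)) := by
  have hn : 0 < n := Fin.pos i₀
  have h1 : ∑ r, (1 - w r) * S.winAt r ≤
      ∑ r, (1 - w r) * ((1 - unseenProb n (r + 1)) * prob (S.claims r)) +
        ∑ r : Fin (n * 2), avg (fun σ => ind (S.claims r σ) *
          |unseenFrac (r + 1) σ - unseenProb n (r + 1)|) := by
    rw [← Finset.sum_add_distrib]
    refine Finset.sum_le_sum fun r _ => ?_
    have h := S.winAt_le_add h₀ r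
    have h2 : 0 ≤ avg (fun σ => ind (S.claims r σ) *
        |unseenFrac (r + 1) σ - unseenProb n (r + 1)|) := by
      rw [← avg_const (n := n) 0]
      exact avg_mono fun σ => mul_nonneg (ind_nonneg _) (abs_nonneg _)
    have h3 := hw r
    nlinarith [h3.1, h3.2]
  refine h1.trans (add_le_add_right ?_ _)
  rw [← avg_sum]
  have h2 : ∀ σ : ArrivalSeq n, ∑ r : Fin (n * 2), ind (S.claims r σ) *
      |unseenFrac (r + 1) σ - unseenProb n (r + 1)| ≤ gridDev J σ + (2 / (J + 1) + 1 / n) := by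
    intro σ
    have h3 : 0 ≤ gridDev J σ + (2 / (J + 1) + 1 / n) :=
      (abs_nonneg _).trans (abs_sub_le_gridDev hn J (Nat.zero_le _) σ)
    calc _ ≤ ∑ r : Fin (n * 2), ind (S.claims r σ) * (gridDev J σ + (2 / (J + 1) + 1 / n)) := by
          refine Finset.sum_le_sum fun r _ => ?_
          exact mul_le_mul_of_nonneg_left (abs_sub_le_gridDev hn J r.2 σ) (ind_nonneg _)
      _ ≤ 1 * (gridDev J σ + (2 / (J + 1) + 1 / n)) := by
          rw [← Finset.sum_mul]
          exact mul_le_mul_of_nonneg_right (S.sum_claims_le σ) h3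
      _ = _ := one_mul _
  refine (avg_mono h2).trans ?_
  rw [avg_add, avg_const]
  exact add_le_add_left (avg_gridDev_le hn J) _

/-- The second way to bound the winning probability, by the first visits of the best secretary that
happen while nobody is accepted.  Each claim ends this period. -/
lemma sum_mul_winAt_le (h₀ : ∀ j, i₀ ≤ j) {w : Fin (n * 2) → ℝ}
    (hw : ∀ r, w r ∈ Set.Icc (0 : ℝ) 1) :
    ∑ r, w r * S.winAt r ≤
      2 / ((n * 2 : ℕ) * ((n * 2 : ℕ) - 1)) *
        (∑ r, w r * (r : ℕ) - ∑ ρ, prob (S.claims ρ) *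
          ∑ r, w r * (max (((r : ℕ) : ℝ) - (ρ : ℕ)) 0 - 1)) +
        2 * (1 + Real.log (n * 2 : ℕ)) * (1 / √n) := by
  have hn : 0 < n := Fin.pos i₀
  have hκ : (0 : ℝ) ≤ 2 / ((n * 2 : ℕ) * ((n * 2 : ℕ) - 1)) := by
    have : (1 : ℝ) ≤ ((n * 2 : ℕ) : ℝ) := by exact_mod_cast (by omega)
    have : (0 : ℝ) ≤ ((n * 2 : ℕ) : ℝ) - 1 := by linarith
    positivity
  set κ : ℝ := 2 / ((n * 2 : ℕ) * ((n * 2 : ℕ) - 1)) with hκdef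
  -- the number of rounds `a < r` after round `ρ`
  have hcount : ∀ r : Fin (n * 2), ∑ a ∈ Finset.range r, prob (S.rejects a) ≤
      (r : ℕ) - ∑ ρ, prob (S.claims ρ) * (max (((r : ℕ) : ℝ) - (ρ : ℕ)) 0 - 1) := by
    intro r
    refine (Finset.sum_le_sum fun a _ => S.prob_rejects_le a).trans ?_
    rw [Finset.sum_sub_distrib]
    simp only [Finset.sum_const, Finset.card_range, nsmul_eq_mul, mul_one]
    refine sub_le_sub_left ?_ _
    simp only [Finset.sum_filter]
    rw [Finset.sum_comm]
    refine Finset.sum_le_sum fun ρ _ => ?_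
    rw [← Finset.sum_filter]
    simp only [Finset.sum_const, nsmul_eq_mul]
    rw [mul_comm]
    apply mul_le_mul_of_nonneg_right _ (prob_nonneg _)
    have e : (Finset.range r).filter (fun a => (ρ : ℕ) < a) = Finset.Ico ((ρ : ℕ) + 1) r := by
      ext a; simp; omega
    rw [e, Nat.card_Ico, tsub_le_iff_right, max_le_iff]
    constructor
    · have : (r : ℕ) ≤ (r : ℕ) - ((ρ : ℕ) + 1) + 1 + ρ := by omega
      have : ((r : ℕ) : ℝ) ≤ ((r : ℕ) - ((ρ : ℕ) + 1) : ℕ) + 1 + (ρ : ℕ) := by exact_mod_cast this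
      linarith
    · positivity
  have hr : ∀ r : Fin (n * 2), w r * S.winAt r ≤
      κ * (w r * (r : ℕ) - ∑ ρ, prob (S.claims ρ) *
        (w r * (max (((r : ℕ) : ℝ) - (ρ : ℕ)) 0 - 1))) +
      2 / (((n * 2 : ℕ) : ℝ) - (r : ℕ)) * (1 / √n) := by
    intro r
    have h1 := S.winAt_le_sum h₀ r
    rw [Finset.sum_add_distrib, ← Finset.mul_sum, ← Finset.sum_mul] at h1
    have h2 : (∑ a ∈ Finset.range r, 2 / ((((n * 2 : ℕ) : ℝ) - a) * ((n * 2 : ℕ) - a - 1))) *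
        (1 / √n) ≤ 2 / (((n * 2 : ℕ) : ℝ) - (r : ℕ)) * (1 / √n) := by
      gcongr
      exact sum_telescope r.2
    have h3 : 0 ≤ 2 / (((n * 2 : ℕ) : ℝ) - (r : ℕ)) * (1 / √n) := by
      have : ((r : ℕ) : ℝ) < ((n * 2 : ℕ) : ℝ) := by exact_mod_cast r.2
      have : 0 < ((n * 2 : ℕ) : ℝ) - (r : ℕ) := by linarith
      positivity
    have h4 := mul_le_mul_of_nonneg_left (hcount r) hκ
    have e : ∑ ρ, prob (S.claims ρ) * (w r * (max (((r : ℕ) : ℝ) - (ρ : ℕ)) 0 - 1)) =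
        w r * ∑ ρ, prob (S.claims ρ) * (max (((r : ℕ) : ℝ) - (ρ : ℕ)) 0 - 1) := by
      rw [Finset.mul_sum]
      exact Finset.sum_congr rfl fun ρ _ => by ring
    rw [e]
    obtain ⟨hw0, hw1⟩ := hw r
    have h5 := mul_le_mul_of_nonneg_left (h1.trans (add_le_add h4 h2)) hw0
    nlinarith
  refine (Finset.sum_le_sum fun r _ => hr r).trans ?_
  rw [Finset.sum_add_distrib, ← Finset.mul_sum, Finset.sum_sub_distrib, Finset.sum_comm,
    ← Finset.sum_mul]
  simp only [← Finset.mul_sum]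
  gcongr
  exact sum_inv_le (n * 2)

/-- The bound on the winning probability given by the dual weights, which tell how much of each
round is charged to either of the two previous bounds.  By feasibility of the weights, the total
coefficient of every claim is then at most of order `1 / n`. -/
lemma sum_winAt_le (h₀ : ∀ j, i₀ ≤ j) (hμ0 : 0 < μ) (hμ1 : μ < 1) (hμ : rejectRatio μ = 1 / 2)
    (J : ℕ) :
    ∑ r, S.winAt r ≤ (n * 2 : ℕ) / ((n * 2 : ℕ) - 1) * limitProb μ + dualError n J := by
  have hn : 0 < n := Fin.pos i₀
  have hw := roundWeight_mem (n := n) hμ0 hμ1 hμ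
  have hsplit : ∑ r, S.winAt r =
      ∑ r, (1 - roundWeight μ r) * S.winAt r + ∑ r : Fin (n * 2), roundWeight μ r * S.winAt r := by
    rw [← Finset.sum_add_distrib]
    exact Finset.sum_congr rfl fun r _ => by ring
  have h1 := S.sum_one_sub_mul_winAt_le h₀ J hw
  have h2 := S.sum_mul_winAt_le h₀ hw
  have hobj := dual_objective_le hn hμ0 hμ1 hμ
  have hcomb : ∑ ρ : Fin (n * 2),
        (1 - roundWeight μ ρ) * ((1 - unseenProb n (ρ + 1)) * prob (S.claims ρ)) -
      2 / ((n * 2 : ℕ) * (((n * 2 : ℕ) : ℝ) - 1)) * ∑ ρ, prob (S.claims ρ) *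
          ∑ r : Fin (n * 2), roundWeight μ r * (max (((r : ℕ) : ℝ) - (ρ : ℕ)) 0 - 1) ≤
      7 / ((n * 2 : ℕ) - 1) := by
    rw [Finset.mul_sum, ← Finset.sum_sub_distrib]
    have hN1 : (0 : ℝ) ≤ 7 / ((n * 2 : ℕ) - 1) := by
      have : (1 : ℝ) ≤ ((n * 2 : ℕ) : ℝ) := by exact_mod_cast (by omega)
      exact div_nonneg (by norm_num) (by linarith)
    calc _ ≤ ∑ ρ, (7 / (((n * 2 : ℕ) : ℝ) - 1)) * prob (S.claims ρ) := by
          refine Finset.sum_le_sum fun ρ _ => ?_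
          have := mul_le_mul_of_nonneg_right (roundWeight_feasible hn hμ0 hμ1 hμ ρ)
            (prob_nonneg (S.claims ρ))
          refine le_trans (le_of_eq ?_) this
          ring
      _ ≤ (7 / (((n * 2 : ℕ) : ℝ) - 1)) * 1 := by
          rw [← Finset.mul_sum]
          exact mul_le_mul_of_nonneg_left S.sum_prob_claims_le hN1
      _ = _ := mul_one _
  rw [hsplit]
  unfold dualError
  rw [mul_sub] at h2
  linarith

end StoppingData

/-! ### Strategies in the order model -/

/-- Relative ranks depend on the relative order only. -/
lemma relRank_congr {s s' : Fin (n * 2) → Fin n} {r : Fin (n * 2)}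
    (h : ∀ q ≤ r, ∀ q' ≤ r, (s q ≤ s q' ↔ s' q ≤ s' q')) : relRank s r = relRank s' r := by
  classical
  have key : ∀ s s' : Fin (n * 2) → Fin n,
      (∀ q ≤ r, ∀ q' ≤ r, (s q ≤ s q' ↔ s' q ≤ s' q')) → relRank s r ≤ relRank s' r := by
    intro s s' h
    have e : ∀ s : Fin (n * 2) → Fin n, relRank s r =
        ((Finset.univ.filter fun q => q ≤ r ∧ s q ≤ s r).image s).card := by
      intro s
      unfold relRank
      congr 1
      ext i
      simp only [Finset.mem_filter, Finset.mem_univ, true_and, Finset.mem_image]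
      constructor
      · rintro ⟨h1, q, h2, rfl⟩; exact ⟨q, ⟨h2, h1⟩, rfl⟩
      · rintro ⟨q, ⟨h1, h2⟩, rfl⟩; exact ⟨h2, q, h1, rfl⟩
    rw [e s, e s']
    obtain ⟨u, hu, hinj, himg⟩ := Finset.exists_subset_injOn_image_eq_of_surjOn (f := s)
      (Finset.univ.filter fun q => q ≤ r ∧ s q ≤ s r)
      ((Finset.univ.filter fun q => q ≤ r ∧ s q ≤ s r).image s) (by
        rw [Finset.coe_image]; exact Set.surjOn_image _ _)
    have hu' : ∀ q ∈ u, q ≤ r ∧ s q ≤ s r := fun q hq => by simpa using hu hq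
    rw [← himg, Finset.card_image_of_injOn hinj]
    have hinj' : Set.InjOn s' u := by
      intro q hq q' hq' hqq
      apply hinj hq hq'
      have h1 := (hu' q hq).1
      have h2 := (hu' q' hq').1
      exact le_antisymm ((h q h1 q' h2).2 hqq.le) ((h q' h2 q h1).2 hqq.ge)
    rw [← Finset.card_image_of_injOn hinj']
    refine Finset.card_le_card fun i hi => ?_
    obtain ⟨q, hq, rfl⟩ := Finset.mem_image.1 hi
    have := hu' q hq
    exact Finset.mem_image_of_mem _ (by simpa using ⟨this.1, (h q this.1 r le_rfl).1 this.2⟩)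
  exact le_antisymm (key s s' h) (key s' s fun q hq q' hq' => (h q hq q' hq').symm)

lemma visit_congr {s s' : Fin (n * 2) → Fin n} {r : Fin (n * 2)}
    (h : ∀ q ≤ r, ∀ q' ≤ r, (s q ≤ s q' ↔ s' q ≤ s' q')) : visit s r = visit s' r := by
  unfold visit
  congr 1
  ext q
  simp only [Finset.mem_filter, Finset.mem_univ, true_and, and_congr_right_iff]
  intro hq
  rw [le_antisymm_iff, le_antisymm_iff, h q hq r le_rfl, h r le_rfl q hq]

lemma history_congr {α : Type} (t : Fin (n * 2) → α) {s s' : Fin (n * 2) → Fin n}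
    {r : Fin (n * 2)} (h : ∀ q ≤ r, ∀ q' ≤ r, (s q ≤ s q' ↔ s' q ≤ s' q')) :
    history t s r = history t s' r := by
  ext1 q
  have hq : (q : Fin (n * 2)) ≤ r := q.2
  have h' : ∀ p ≤ (q : Fin (n * 2)), ∀ p' ≤ (q : Fin (n * 2)), (s p ≤ s p' ↔ s' p ≤ s' p') :=
    fun p hp p' hp' => h p (hp.trans hq) p' (hp'.trans hq)
  unfold history
  rw [relRank_congr h', visit_congr h']

lemma not_three_visits (σ : ArrivalSeq n) {a b c : Fin (n * 2)} (hab : a < b) (hbc : b < c)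
    (h1 : (σ a).1 = (σ b).1) (h2 : (σ b).1 = (σ c).1) : False := by
  have h : ∀ p q : Fin (n * 2), p < q → (σ p).1 = (σ q).1 → (σ p).2 ≠ (σ q).2 :=
    fun p q hpq h1 h2 => hpq.ne (σ.injective (Prod.ext h1 h2))
  have e1 := h a b hab h1
  have e2 := h b c hbc h2
  have e3 := h a c (hab.trans hbc) (h1.trans h2)
  omega

/-- The strategy accepts in round `r` the secretary of round `q`, and nobody before. -/
def Strategy.Accepts (S : Strategy n Unit) (u : ℝ) (σ : ArrivalSeq n) (r : Fin (n * 2))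
    (q : Set.Iic r) : Prop :=
  (∀ r' < r, S.act r' u (history (fun _ => ()) (fun r => (σ r).1) r') = none) ∧
    S.act r u (history (fun _ => ()) (fun r => (σ r).1) r) = some q

lemma Strategy.Accepts.eq {S : Strategy n Unit} {u : ℝ} {σ : ArrivalSeq n} {r r' : Fin (n * 2)}
    {q : Set.Iic r} {q' : Set.Iic r'} (h : S.Accepts u σ r q) (h' : S.Accepts u σ r' q') :
    (q : Fin (n * 2)) = q' := by
  rcases lt_trichotomy r r' with hr | hr | hr
  · have := h'.1 r hr; rw [h.2] at this; cases this
  · subst hr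
    have := h.2.symm.trans h'.2
    simp only [Option.some.injEq] at this
    rw [this]
  · have := h.1 r' hr; rw [h'.2] at this; cases this

lemma Strategy.Accepts.congr {S : Strategy n Unit} {u : ℝ} {σ σ' : ArrivalSeq n}
    {r : Fin (n * 2)} {q : Set.Iic r}
    (h : ∀ q ≤ r, ∀ q' ≤ r, ((σ q).1 ≤ (σ q').1 ↔ (σ' q).1 ≤ (σ' q').1))
    (hσ : S.Accepts u σ r q) : S.Accepts u σ' r q := by
  have e : ∀ r' ≤ r, history (fun _ => ()) (fun r => (σ r).1) r' =
      history (fun _ => ()) (fun r => (σ' r).1) r' := fun r' hr' =>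
    history_congr _ fun p hp p' hp' => h p (hp.trans hr') p' (hp'.trans hr')
  exact ⟨fun r' hr' => by rw [← e r' hr'.le]; exact hσ.1 r' hr', by rw [← e r le_rfl]; exact hσ.2⟩

/-- The stopping data of a strategy with a given seed.  A claim requires a second visit, so that
two claims cannot concern the same secretary. -/
def Strategy.stoppingData (S : Strategy n Unit) (u : ℝ) (i₀ : Fin n) : StoppingData n i₀ where
  rejects a σ := ∀ r : Fin (n * 2), (r : ℕ) < a →
    S.act r u (history (fun _ => ()) (fun r => (σ r).1) r) = none
  claims r σ := (∀ q ≤ r, (σ r).1 ≤ (σ q).1) ∧ (∃ q < r, (σ q).1 = (σ r).1) ∧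
    ∃ r' ≤ r, ∃ q : Set.Iic r', S.Accepts u σ r' q ∧ (σ q).1 = (σ r).1
  adapted_rejects a σ σ' h hσ r hr := by
    rw [← hσ r hr]
    congr 1
    exact history_congr _ fun q hq q' hq' =>
      (h q q' (by have := Fin.le_def.1 hq; omega) (by have := Fin.le_def.1 hq'; omega)).symm
  adapted_claims r σ σ' h hσ := by
    have h' : ∀ q ≤ r, ∀ q' ≤ r, ((σ q).1 ≤ (σ q').1 ↔ (σ' q).1 ≤ (σ' q').1) :=
      fun q hq q' hq' => h q q' (Nat.lt_succ_of_le hq) (Nat.lt_succ_of_le hq')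
    have he : ∀ q ≤ r, ((σ q).1 = (σ r).1 → (σ' q).1 = (σ' r).1) := fun q hq e =>
      le_antisymm ((h' q hq r le_rfl).1 e.le) ((h' r le_rfl q hq).1 e.ge)
    obtain ⟨h1, ⟨q, hq, hqr⟩, r', hr', p, hp, hpr⟩ := hσ
    refine ⟨fun q hq => (h' r le_rfl q hq).1 (h1 q hq), ⟨q, hq, he q hq.le hqr⟩, r', hr', p,
      hp.congr fun q hq q' hq' => h' q (hq.trans hr') q' (hq'.trans hr'), he p (p.2.trans hr') hpr⟩
  disjoint a σ := by
    set claims : Fin (n * 2) → Prop := fun r => (∀ q ≤ r, (σ r).1 ≤ (σ q).1) ∧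
      (∃ q < r, (σ q).1 = (σ r).1) ∧
        ∃ r' ≤ r, ∃ q : Set.Iic r', S.Accepts u σ r' q ∧ (σ q).1 = (σ r).1
    show _ + ∑ r ∈ Finset.univ.filter (fun r : Fin (n * 2) => (r : ℕ) < a), ind (claims r) ≤ 1
    by_cases hc : ∃ r : Fin (n * 2), (r : ℕ) < a ∧ claims r
    · obtain ⟨r, hra, hr⟩ := hc
      have hsum : ∑ r ∈ Finset.univ.filter (fun r : Fin (n * 2) => (r : ℕ) < a), ind (claims r) =
          ind (claims r) := by
        apply Finset.sum_eq_single_of_mem r (by simpa using hra)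
        intro r2 _ hne
        apply ind_of_false
        intro hr2
        -- two claims concern the same secretary, who has only one second visit
        obtain ⟨-, ⟨p, hp, hpr⟩, r', hr', q, hq, hqr⟩ := hr
        obtain ⟨-, ⟨p2, hp2, hpr2⟩, r2', hr2', q2, hq2, hqr2⟩ := hr2
        have e : (σ r).1 = (σ r2).1 := by rw [← hqr, ← hqr2, hq.eq hq2]
        rcases lt_or_gt_of_ne hne with hlt | hlt
        · exact not_three_visits σ hp2 hlt hpr2 e.symm
        · exact not_three_visits σ hp hlt hpr e
      rw [hsum, ind_of_false, zero_add]
      · exact ind_le_one _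
      · intro hrej
        obtain ⟨-, -, r', hr', q, hq, -⟩ := hr
        have := hrej r' (lt_of_le_of_lt (Fin.le_def.1 hr') hra)
        rw [hq.2] at this
        cases this
    · rw [Finset.sum_eq_zero, add_zero]
      · exact ind_le_one _
      · intro r hr
        exact ind_of_false fun h => hc ⟨r, by simpa using hr, h⟩
  best r σ h := h.1
  first_visit r σ h hr := by
    obtain ⟨-, ⟨a, ha, har⟩, r', hr', q, hq, hqr⟩ := h
    have haq : a ≤ q := by
      by_contra hlt
      exact not_three_visits σ (not_le.1 hlt) ha (hqr.trans har.symm) har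
    refine ⟨a, ha, fun r'' hr'' => hq.1 r'' ?_, fun p hp => ?_, har.trans hr⟩
    · have h1 : (q : Fin (n * 2)) ≤ r' := q.2
      exact lt_of_lt_of_le (Fin.lt_def.2 hr'') (haq.trans h1)
    · rw [Finset.mem_singleton]
      intro hpi
      exact not_three_visits σ (Fin.lt_def.2 hp) ha (hpi.trans (har.trans hr).symm) har

/-- A win is a claim at the second visit of the best secretary, even if he is accepted earlier. -/
lemma Strategy.Wins.exists_claims {S : Strategy n Unit} {u : ℝ} {i₀ : Fin n} (h₀ : ∀ j, i₀ ≤ j)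
    {σ : ArrivalSeq n} (h : S.Wins u (fun _ => ()) (fun r => (σ r).1)) :
    ∃ r, (S.stoppingData u i₀).claims r σ ∧ (σ r).1 = i₀ := by
  obtain ⟨r', q, h1, h2, ⟨q', hq', hqq⟩, hbest⟩ := h
  have hq : (σ q).1 = i₀ := le_antisymm (hbest i₀) (h₀ _)
  have hex : ∀ c : Fin 2, (σ (σ.symm (i₀, c))).1 = i₀ := fun c => by simp
  have hne : σ.symm (i₀, 0) ≠ σ.symm (i₀, 1) := by simp
  -- the two rounds of the best secretary
  obtain ⟨a, r, har, ha, hr⟩ : ∃ a r, a < r ∧ (σ a).1 = i₀ ∧ (σ r).1 = i₀ := by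
    rcases lt_or_gt_of_ne hne with h | h
    · exact ⟨_, _, h, hex 0, hex 1⟩
    · exact ⟨_, _, h, hex 1, hex 0⟩
  have hle : ∀ p, (σ p).1 = i₀ → p ≤ r := by
    intro p hp
    by_contra hlt
    exact not_three_visits σ har (not_le.1 hlt) (ha.trans hr.symm) (hr.trans hp.symm)
  exact ⟨r, ⟨fun p _ => by rw [hr]; exact h₀ _, ⟨a, har, ha.trans hr.symm⟩, r',
    hq'.trans (hle q' (hqq.trans hq)), q, ⟨h1, h2⟩, hq.trans hr.symm⟩, hr⟩

instance : IsProbabilityMeasure uniform01 :=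
  ⟨by simp [uniform01]⟩

lemma measurable_history {α : Type} [MeasurableSpace α] (s : Fin (n * 2) → Fin n)
    (r : Fin (n * 2)) :
    Measurable fun p : ℝ × (Fin (n * 2) → α) => (p.1, history p.2 s r) := by
  unfold history
  fun_prop

lemma Strategy.measurableSet_wins {α : Type} [MeasurableSpace α] (S : Strategy n α)
    (s : Fin (n * 2) → Fin n) :
    MeasurableSet {p : ℝ × (Fin (n * 2) → α) | S.Wins p.1 p.2 s} := by
  have h : ∀ (r : Fin (n * 2)) (a : Option (Set.Iic r)),
      MeasurableSet {p : ℝ × (Fin (n * 2) → α) | S.act r p.1 (history p.2 s r) = a} :=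
    fun r a => measurable_history s r (S.measurableSet_act r a)
  simp only [measurableSet_setOfPred] at h ⊢
  unfold Strategy.Wins
  exact Measurable.exists fun r => Measurable.exists fun q => (Measurable.forall fun r' =>
    Measurable.forall fun _ => h r' none).and ((h r (some q)).and (measurable_const.and
      measurable_const))

lemma Strategy.measurableSet_wins_seed {α : Type} [MeasurableSpace α] (S : Strategy n α)
    (t : Fin (n * 2) → α) (s : Fin (n * 2) → Fin n) : MeasurableSet {u | S.Wins u t s} :=
  (measurable_id.prodMk measurable_const) (S.measurableSet_wins s)

/-- If, for every seed, the winning probability is at most `c`, so it is on average. -/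
lemma winProbOrder_le (S : Strategy n Unit) {c : ℝ}
    (h : ∀ u, prob (fun σ : ArrivalSeq n => S.Wins u (fun _ => ()) fun r => (σ r).1) ≤ c) :
    winProbOrder S ≤ c := by
  have e : winProbOrder S =
      ∫ u, prob (fun σ : ArrivalSeq n => S.Wins u (fun _ => ()) fun r => (σ r).1) ∂uniform01 := by
    unfold winProbOrder prob avg
    rw [integral_div, integral_finsetSum]
    · congr 1
      refine Finset.sum_congr rfl fun σ _ => ?_
      rw [← integral_indicator_one (S.measurableSet_wins_seed _ _)]
      rfl
    · intro σ _
      exact (integrable_const (1 : ℝ)).indicator (S.measurableSet_wins_seed _ _)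
  rw [e]
  have hint : Integrable (fun u => prob (fun σ : ArrivalSeq n =>
      S.Wins u (fun _ => ()) fun r => (σ r).1)) uniform01 := by
    unfold prob avg
    refine Integrable.div_const (integrable_finsetSum _ fun σ _ => ?_) _
    exact (integrable_const (1 : ℝ)).indicator (S.measurableSet_wins_seed _ _)
  calc _ ≤ ∫ _, c ∂uniform01 := integral_mono hint (integrable_const c) h
    _ = c := by simp

lemma winProbOrder_le_one (S : Strategy n Unit) : winProbOrder S ≤ 1 :=
  winProbOrder_le S fun _ => prob_le_one _

lemma bddAbove_winProbOrder (n : ℕ) :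
    BddAbove (Set.range fun S : Strategy n Unit => winProbOrder S) :=
  ⟨1, by rintro _ ⟨S, rfl⟩; exact winProbOrder_le_one S⟩

/-- The strategy that accepts nobody. -/
instance {α : Type} [MeasurableSpace α] : Nonempty (Strategy n α) :=
  ⟨⟨fun _ _ _ => none, fun _ a => by by_cases h : none = a <;> simp [h]⟩⟩

/-- The dual bound on the optimal winning probability in the order model. -/
lemma optimalOrder_le (hn : 0 < n) {μ : ℝ} (hμ0 : 0 < μ) (hμ1 : μ < 1)
    (hμ : rejectRatio μ = 1 / 2) (J : ℕ) :
    optimalOrder n ≤ (n * 2 : ℕ) / ((n * 2 : ℕ) - 1) * limitProb μ + dualError n J := by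
  refine ciSup_le fun S => winProbOrder_le S fun u => ?_
  have h₀ : ∀ j, (⟨0, hn⟩ : Fin n) ≤ j := fun j => Fin.le_def.2 (Nat.zero_le _)
  refine le_trans ?_ ((S.stoppingData u ⟨0, hn⟩).sum_winAt_le h₀ hμ0 hμ1 hμ J)
  unfold StoppingData.winAt prob
  rw [← avg_sum]
  refine avg_mono fun σ => ?_
  by_cases h : S.Wins u (fun _ => ()) fun r => (σ r).1
  · obtain ⟨r, hr⟩ := h.exists_claims h₀
    rw [ind_of_true h, ← ind_of_true hr]
    exact Finset.single_le_sum
      (f := fun r => ind ((S.stoppingData u ⟨0, hn⟩).claims r σ ∧ (σ r).1 = ⟨0, hn⟩))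
      (fun _ _ => ind_nonneg _) (Finset.mem_univ r)
  · rw [ind_of_false h]
    exact Finset.sum_nonneg fun _ _ => ind_nonneg _

lemma tendsto_dualError (J : ℕ) :
    Tendsto (fun n => dualError n J) atTop (𝓝 (2 / (J + 1))) := by
  have hN : Tendsto (fun n : ℕ => (n : ℝ)) atTop atTop := tendsto_natCast_atTop_atTop
  have hs : Tendsto (fun n : ℕ => √(n : ℝ)) atTop atTop := Real.tendsto_sqrt_atTop.comp hN
  have h1 : Tendsto (fun n : ℕ => 7 / (((n * 2 : ℕ) : ℝ) - 1)) atTop (𝓝 0) := by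
    apply Tendsto.const_div_atTop
    push_cast
    exact tendsto_atTop_add_const_right _ (-1) (hN.atTop_mul_const (by norm_num : (0:ℝ) < 2))
  have h2 : Tendsto (fun n : ℕ => ((J : ℝ) + 2) / √n) atTop (𝓝 0) := hs.const_div_atTop _
  have h3 : Tendsto (fun n : ℕ => 1 / (n : ℝ)) atTop (𝓝 0) := hN.const_div_atTop _
  have h4 : Tendsto (fun n : ℕ => 2 * (1 + Real.log (n * 2 : ℕ)) * (1 / √n)) atTop (𝓝 0) := by
    have hlog : Tendsto (fun x : ℝ => Real.log x / √x) atTop (𝓝 0) := by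
      have := isLittleO_log_rpow_atTop (r := 1 / 2) (by norm_num)
      have := this.tendsto_div_nhds_zero
      simpa only [Real.sqrt_eq_rpow] using this
    have h5 := hlog.comp hN
    have h6 : Tendsto (fun n : ℕ => 2 * ((1 + Real.log 2) / √(n : ℝ) + Real.log n / √n)) atTop
        (𝓝 (2 * (0 + 0))) := ((hs.const_div_atTop _).add h5).const_mul 2
    simp only [add_zero, mul_zero] at h6
    refine h6.congr' ?_
    filter_upwards [eventually_gt_atTop 0] with n hn
    have hn' : (n : ℝ) ≠ 0 := by exact_mod_cast hn.ne'
    push_cast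
    rw [Real.log_mul hn' (by norm_num)]
    ring
  have := ((h1.add h2).add (h3.const_add (2 / ((J : ℝ) + 1)))).add h4
  simpa [dualError] using this

lemma eventually_optimalOrder_lt {μ : ℝ} (hμ0 : 0 < μ) (hμ1 : μ < 1)
    (hμ : rejectRatio μ = 1 / 2) {ε : ℝ} (hε : 0 < ε) :
    ∀ᶠ n in atTop, optimalOrder n < limitProb μ + ε := by
  obtain ⟨J, hJ⟩ := exists_nat_gt (2 / ε)
  have hJ' : 2 / ((J : ℝ) + 1) < ε := by
    rw [div_lt_iff₀ hε] at hJ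
    rw [div_lt_iff₀ (by positivity)]
    nlinarith
  have h1 : Tendsto (fun n : ℕ => ((n * 2 : ℕ) : ℝ) / ((n * 2 : ℕ) - 1)) atTop (𝓝 1) := by
    have h2 : Tendsto (fun n : ℕ => 1 / (((n * 2 : ℕ) : ℝ) - 1)) atTop (𝓝 0) := by
      apply Tendsto.const_div_atTop
      push_cast
      exact tendsto_atTop_add_const_right _ (-1)
        (tendsto_natCast_atTop_atTop.atTop_mul_const (by norm_num : (0:ℝ) < 2))
    have h3 := h2.const_add 1
    rw [add_zero] at h3
    refine h3.congr' ?_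
    filter_upwards [eventually_gt_atTop 0] with n hn
    have : (2 : ℝ) ≤ ((n * 2 : ℕ) : ℝ) := by exact_mod_cast (by omega : 2 ≤ n * 2)
    have : ((n * 2 : ℕ) : ℝ) - 1 ≠ 0 := by linarith
    field_simp
    ring
  have h2 := (h1.mul_const (limitProb μ)).add (tendsto_dualError J)
  rw [one_mul] at h2
  filter_upwards [h2.eventually_lt_const (u := limitProb μ + ε) (by linarith),
    eventually_gt_atTop 0] with n hn hn0
  exact (optimalOrder_le hn0 hμ0 hμ1 hμ J).trans_lt hn

/-! ### Time model and order model -/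

/-- The joint law of independent arrival times. -/
abbrev timesLaw (ι : Type) [Fintype ι] : Measure (ι → ℝ) := Measure.pi fun _ => uniform01

lemma ae_injective (ι : Type) [Fintype ι] : ∀ᵐ T ∂timesLaw ι, Function.Injective T := by
  classical
  have h : timesLaw ι = (volume : Measure (ι → ℝ)).restrict
      (Set.univ.pi fun _ => Set.Ico (0 : ℝ) 1) := (Measure.restrict_pi_pi _ _).symm
  rw [h]
  apply ae_restrict_of_ae
  have h2 : ∀ i j : ι, i ≠ j → ∀ᵐ T : ι → ℝ, T i ≠ T j := by
    intro i j hij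
    have h3 := Measure.addHaar_submodule (volume : Measure (ι → ℝ))
      (LinearMap.ker (LinearMap.proj (R := ℝ) (φ := fun _ : ι => ℝ) i - LinearMap.proj j)) (by
        intro htop
        have : Pi.single i (1 : ℝ) ∈ LinearMap.ker
          (LinearMap.proj (R := ℝ) (φ := fun _ : ι => ℝ) i - LinearMap.proj j) := by
            rw [htop]; trivial
        simp [hij.symm] at this)
    rw [ae_iff]
    refine measure_mono_null (fun T hT => ?_) h3
    have hT' : T i = T j := by simpa using hT
    simp [hT']
  have h4 : ∀ᵐ T : ι → ℝ, ∀ i j, i ≠ j → T i ≠ T j := by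
    rw [ae_all_iff]; intro i
    rw [ae_all_iff]; intro j
    by_cases hij : i = j
    · simp [hij]
    · filter_upwards [h2 i j hij] with T hT _ using hT
  filter_upwards [h4] with T hT i j hij
  by_contra hne
  exact hT i j hne hij

lemma strictMono_comp_arrivalOrder {T : Fin n × Fin 2 → ℝ} (hT : Function.Injective T) :
    StrictMono (T ∘ arrivalOrder T) := by
  have h : Monotone (T ∘ arrivalOrder T) := Tuple.monotone_sort (T ∘ finProdFinEquiv.symm)
  exact h.strictMono_of_injective (hT.comp (arrivalOrder T).injective)

lemma eq_arrivalOrder {T : Fin n × Fin 2 → ℝ} (hT : Function.Injective T) {σ : ArrivalSeq n}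
    (hσ : StrictMono (T ∘ σ)) : arrivalOrder T = σ := by
  have h := (StrictMono.range_inj (strictMono_comp_arrivalOrder hT) hσ).1 (by
    rw [Set.range_comp, Set.range_comp, Equiv.range_eq_univ, Equiv.range_eq_univ])
  ext1 r
  exact hT (congrFun h r)

lemma measurePreserving_comp (σ : ArrivalSeq n) :
    MeasurePreserving (fun T : Fin n × Fin 2 → ℝ => T ∘ σ) (timesLaw _) (timesLaw _) := by
  have h := measurePreserving_piCongrLeft (α := fun _ : Fin (n * 2) => ℝ)
    (fun _ : Fin (n * 2) => uniform01) σ.symm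
  convert h using 1
  ext T r
  have := MeasurableEquiv.piCongrLeft_apply_apply (β := fun _ : Fin (n * 2) => ℝ) σ.symm T (σ r)
  simpa using this.symm

lemma measurableSet_strictMono : MeasurableSet {t : Fin (n * 2) → ℝ | StrictMono t} := by
  have : {t : Fin (n * 2) → ℝ | StrictMono t} = ⋂ i, ⋂ j, ⋂ (_ : i < j), {t | t i < t j} := by
    ext t; simp [StrictMono]
  rw [this]
  exact MeasurableSet.iInter fun i => MeasurableSet.iInter fun j => MeasurableSet.iInter fun _ =>
    measurableSet_lt (measurable_pi_apply i) (measurable_pi_apply j)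

/-- The order of the arrivals and the sorted arrival times are independent, and all orders are
equally likely. -/
lemma real_arrivalOrder_eq_sum (B : ArrivalSeq n → Set (ℝ × (Fin (n * 2) → ℝ)))
    (hB : ∀ σ, MeasurableSet (B σ)) :
    (uniform01.prod (timesLaw (Fin n × Fin 2))).real
        {p | (p.1, p.2 ∘ arrivalOrder p.2) ∈ B (arrivalOrder p.2)} =
      ∑ σ, (uniform01.prod (timesLaw (Fin (n * 2)))).real {q | StrictMono q.2 ∧ q ∈ B σ} := by
  have hF : ∀ σ, MeasurableSet {q : ℝ × (Fin (n * 2) → ℝ) | StrictMono q.2 ∧ q ∈ B σ} := fun σ =>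
    (measurable_snd measurableSet_strictMono).inter (hB σ)
  have hpres : ∀ σ : ArrivalSeq n, MeasurePreserving
      (fun p : ℝ × (Fin n × Fin 2 → ℝ) => (p.1, p.2 ∘ σ))
      (uniform01.prod (timesLaw _)) (uniform01.prod (timesLaw _)) := fun σ =>
    (MeasurePreserving.id uniform01).prod (measurePreserving_comp σ)
  have hinj : ∀ᵐ p ∂(uniform01.prod (timesLaw (Fin n × Fin 2))), Function.Injective p.2 :=
    Measure.quasiMeasurePreserving_snd.ae (ae_injective _)
  have hE : ∀ σ : ArrivalSeq n, (uniform01.prod (timesLaw (Fin (n * 2)))).real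
      {q | StrictMono q.2 ∧ q ∈ B σ} = (uniform01.prod (timesLaw (Fin n × Fin 2))).real
        {p | Function.Injective p.2 ∧ StrictMono (p.2 ∘ σ) ∧ (p.1, p.2 ∘ σ) ∈ B σ} := by
    intro σ
    rw [← (hpres σ).measureReal_preimage (hF σ).nullMeasurableSet]
    apply measureReal_congr
    filter_upwards [hinj] with p hp
    exact propext ⟨fun h => ⟨hp, h⟩, fun h => h.2⟩
  have hmeas : ∀ σ : ArrivalSeq n, NullMeasurableSet
      {p : ℝ × (Fin n × Fin 2 → ℝ) |
        Function.Injective p.2 ∧ StrictMono (p.2 ∘ σ) ∧ (p.1, p.2 ∘ σ) ∈ B σ}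
      (uniform01.prod (timesLaw (Fin n × Fin 2))) := by
    intro σ
    refine ((hpres σ).measurable (hF σ)).nullMeasurableSet.congr ?_
    filter_upwards [hinj] with p hp
    exact propext ⟨fun h => ⟨hp, h⟩, fun h => h.2⟩
  simp only [hE]
  rw [← measureReal_biUnion_finset₀ _ fun σ _ => hmeas σ]
  · apply measureReal_congr
    filter_upwards [hinj] with p hp
    apply propext
    show _ ↔ p ∈ ⋃ σ ∈ Finset.univ, _
    simp only [Finset.mem_univ, Set.iUnion_true, Set.mem_iUnion]
    constructor
    · exact fun h => ⟨_, hp, strictMono_comp_arrivalOrder hp, h⟩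
    · rintro ⟨σ, -, h1, h2⟩
      have := eq_arrivalOrder hp h1
      subst this
      exact h2
  · intro σ _ σ' _ hne
    refine Disjoint.aedisjoint ?_
    rw [Set.disjoint_left]
    rintro p ⟨hp, h1, -⟩ ⟨-, h2, -⟩
    exact hne ((eq_arrivalOrder hp h1).symm.trans (eq_arrivalOrder hp h2))

/-- The strategy in the order model that pretends that the arrivals take place at the times `t`. -/
def Strategy.withTimes (S : Strategy n ℝ) (t : Fin (n * 2) → ℝ) : Strategy n Unit where
  act r u h := S.act r u fun q => (t q, (h q).2)
  measurableSet_act r a := by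
    have : Measurable fun p : ℝ × History n Unit r =>
        ((p.1, fun q => (t q, (p.2 q).2)) : ℝ × History n ℝ r) := by fun_prop
    exact this (S.measurableSet_act r a)

lemma winProb_le_one (S : Strategy n ℝ) : winProb S ≤ 1 := measureReal_le_one

lemma bddAbove_winProb (n : ℕ) : BddAbove (Set.range fun S : Strategy n ℝ => winProb S) :=
  ⟨1, by rintro _ ⟨S, rfl⟩; exact winProb_le_one S⟩

lemma real_prod_strictMono_and (C : Set (ℝ × (Fin (n * 2) → ℝ))) (hC : MeasurableSet C) :
    (uniform01.prod (timesLaw (Fin (n * 2)))).real {q | StrictMono q.2 ∧ q ∈ C} =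
      ∫ t in {t | StrictMono t}, uniform01.real {u | (u, t) ∈ C} ∂timesLaw (Fin (n * 2)) := by
  have hF : MeasurableSet {q : ℝ × (Fin (n * 2) → ℝ) | StrictMono q.2 ∧ q ∈ C} :=
    (measurable_snd measurableSet_strictMono).inter hC
  rw [measureReal_def, Measure.prod_apply_symm hF, ← integral_toReal,
    ← integral_indicator measurableSet_strictMono]
  · congr 1
    ext t
    by_cases ht : StrictMono t
    · rw [Set.indicator_of_mem (by exact ht)]
      simp [ht, measureReal_def, Set.preimage]
    · rw [Set.indicator_of_notMem (by exact ht)]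
      simp [ht]
  · exact (measurable_measure_prodMk_right hF).aemeasurable
  · filter_upwards with t using measure_lt_top _ _

/-- Times do not help: given the sorted times, a strategy of the time model is a strategy of the
order model. -/
lemma optimal_le_optimalOrder (n : ℕ) : optimal n ≤ optimalOrder n := by
  refine ciSup_le fun S => ?_
  have h1 := real_arrivalOrder_eq_sum (n := n)
    (fun σ => {q | S.Wins q.1 q.2 fun r => (σ r).1}) fun σ => S.measurableSet_wins _
  have h2 := real_arrivalOrder_eq_sum (n := n) (fun _ => Set.univ) fun σ => MeasurableSet.univ
  have hle : ∀ t, ∑ σ : ArrivalSeq n, uniform01.real {u | S.Wins u t fun r => (σ r).1} ≤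
      Fintype.card (ArrivalSeq n) * optimalOrder n := by
    intro t
    have := le_ciSup (bddAbove_winProbOrder n) (S.withTimes t)
    have h3 : winProbOrder (S.withTimes t) =
        (∑ σ : ArrivalSeq n, uniform01.real {u | S.Wins u t fun r => (σ r).1}) /
          Fintype.card (ArrivalSeq n) := rfl
    rw [h3, div_le_iff₀ card_arrivalSeq_pos] at this
    exact this.trans_eq (mul_comm _ _)
  have hint : ∀ σ : ArrivalSeq n, Integrable
      (fun t => uniform01.real {u | S.Wins u t fun r => (σ r).1})
      ((timesLaw (Fin (n * 2))).restrict {t | StrictMono t}) := by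
    intro σ
    refine Integrable.of_bound (C := 1) ?_ ?_
    · exact (measurable_measure_prodMk_right
        (S.measurableSet_wins fun r => (σ r).1)).ennreal_toReal.aestronglyMeasurable
    · filter_upwards with t
      rw [Real.norm_of_nonneg measureReal_nonneg]
      exact measureReal_le_one
  have e1 : winProb S = ∫ t in {t | StrictMono t},
      ∑ σ : ArrivalSeq n, uniform01.real {u | S.Wins u t fun r => (σ r).1}
        ∂timesLaw (Fin (n * 2)) := by
    rw [integral_finsetSum _ fun σ _ => hint σ]
    refine Eq.trans ?_ (h1.trans (Finset.sum_congr rfl fun σ _ =>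
      real_prod_strictMono_and _ (S.measurableSet_wins _)))
    rfl
  have e2 : Fintype.card (ArrivalSeq n) * (timesLaw (Fin (n * 2))).real {t | StrictMono t} = 1 := by
    rw [Finset.sum_congr rfl fun σ _ => real_prod_strictMono_and _ MeasurableSet.univ] at h2
    simpa using h2.symm
  rw [e1]
  calc _ ≤ ∫ _ in {t | StrictMono t}, Fintype.card (ArrivalSeq n) * optimalOrder n
        ∂timesLaw (Fin (n * 2)) :=
        integral_mono (integrable_finsetSum _ fun σ _ => hint σ) (integrable_const _) hle
    _ = optimalOrder n := by
        rw [setIntegral_const, smul_eq_mul, ← mul_assoc, mul_comm _ (Fintype.card _ : ℝ), e2,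
          one_mul]

/-! ### The threshold algorithm in terms of the arrival times -/

/-- The time of the first visit. -/
def firstVisit (T : Fin n × Fin 2 → ℝ) (i : Fin n) : ℝ := min (T (i, 0)) (T (i, 1))

/-- The time of the second visit. -/
def secondVisit (T : Fin n × Fin 2 → ℝ) (i : Fin n) : ℝ := max (T (i, 0)) (T (i, 1))

/-- Between the times `m` and `x` there is no second visit of a best-so-far secretary. -/
def NoAccept (m x : ℝ) (T : Fin n × Fin 2 → ℝ) : Prop :=
  ∀ i, m ≤ secondVisit T i → secondVisit T i < x → ∃ j < i, firstVisit T j ≤ secondVisit T i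

lemma visit_eq_two_iff {T : Fin n × Fin 2 → ℝ} {σ : ArrivalSeq n} (h : StrictMono (T ∘ σ))
    (r : Fin (n * 2)) :
    visit (fun r => (σ r).1) r = 2 ↔ T (σ r) = secondVisit T (σ r).1 := by
  classical
  have hle : T (σ r) ≤ secondVisit T (σ r).1 := by
    have : ∀ c : Fin 2, T ((σ r).1, c) ≤ secondVisit T (σ r).1 := by
      intro c; fin_cases c <;> simp [secondVisit]
    exact this (σ r).2
  set F := Finset.univ.filter fun q : Fin (n * 2) => (σ q).1 = (σ r).1 with hF
  have hFcard : F.card = 2 := by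
    have e : F = Finset.univ.image fun c : Fin 2 => σ.symm ((σ r).1, c) := by
      ext q
      simp only [hF, Finset.mem_filter, Finset.mem_univ, true_and, Finset.mem_image]
      constructor
      · intro hq
        exact ⟨(σ q).2, by rw [← hq]; simp⟩
      · rintro ⟨c, rfl⟩; simp
    rw [e, Finset.card_image_of_injective]
    · simp
    · intro c c' hc
      simpa using hc
  have hv : visit (fun r => (σ r).1) r = (F.filter fun q => q ≤ r).card := by
    unfold visit
    congr 1
    ext q; simp [hF, and_comm]
  have hcard := Finset.card_filter_eq_iff (s := F) (p := fun q => q ≤ r)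
  rw [hFcard] at hcard
  rw [hv, hcard]
  have hmem : ∀ q, q ∈ F ↔ (σ q).1 = (σ r).1 := by simp [hF]
  constructor
  · intro hq
    refine le_antisymm hle ?_
    have : ∀ c : Fin 2, T ((σ r).1, c) ≤ T (σ r) := by
      intro c
      have h2 := h.monotone (hq (σ.symm ((σ r).1, c)) (by rw [hmem]; simp))
      simpa using h2
    exact max_le (this 0) (this 1)
  · intro hT q hq
    rw [← h.le_iff_le]
    show T (σ q) ≤ T (σ r)
    rw [hT, ← (hmem q).1 hq]
    have : ∀ c : Fin 2, T ((σ q).1, c) ≤ secondVisit T (σ q).1 := by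
      intro c; fin_cases c <;> simp [secondVisit]
    exact this (σ q).2

lemma relRank_eq_one_iff {T : Fin n × Fin 2 → ℝ} {σ : ArrivalSeq n} (h : StrictMono (T ∘ σ))
    (r : Fin (n * 2)) :
    relRank (fun r => (σ r).1) r = 1 ↔ ∀ j < (σ r).1, T (σ r) < firstVisit T j := by
  have hseen : ∀ j, (∃ q, q ≤ r ∧ (σ q).1 = j) ↔ firstVisit T j ≤ T (σ r) := by
    intro j
    unfold firstVisit
    constructor
    · rintro ⟨q, hq, rfl⟩
      have h2 : T (σ q) ≤ T (σ r) := h.monotone hq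
      have : ∀ c : Fin 2, firstVisit T (σ q).1 ≤ T ((σ q).1, c) := by
        intro c; fin_cases c <;> simp [firstVisit]
      exact (this (σ q).2).trans h2
    · intro hj
      have key : ∀ c, T (j, c) ≤ T (σ r) → ∃ q, q ≤ r ∧ (σ q).1 = j := by
        intro c hc
        refine ⟨σ.symm (j, c), ?_, by simp⟩
        rw [← h.le_iff_le]
        simpa using hc
      rcases min_le_iff.1 hj with h1 | h1
      · exact key 0 h1
      · exact key 1 h1
  unfold relRank
  simp only [hseen]
  constructor
  · intro hc j hj
    by_contra hlt
    obtain ⟨i, hi⟩ := Finset.card_eq_one.1 hc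
    have h1 : j ∈ Finset.univ.filter fun i : Fin n => i ≤ (σ r).1 ∧ firstVisit T i ≤ T (σ r) := by
      simpa using ⟨hj.le, not_lt.1 hlt⟩
    have h2 : (σ r).1 ∈
        Finset.univ.filter fun i : Fin n => i ≤ (σ r).1 ∧ firstVisit T i ≤ T (σ r) := by
      simpa using (hseen _).1 ⟨r, le_rfl, rfl⟩
    rw [hi, Finset.mem_singleton] at h1 h2
    exact hj.ne (h1.trans h2.symm)
  · intro hj
    rw [Finset.card_eq_one]
    refine ⟨(σ r).1, ?_⟩
    ext i
    simp only [Finset.mem_filter, Finset.mem_univ, true_and, Finset.mem_singleton]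
    constructor
    · rintro ⟨h1, h2⟩
      by_contra hne
      exact absurd (hj i (lt_of_le_of_ne h1 hne)) (not_lt.2 h2)
    · rintro rfl
      exact ⟨le_rfl, (hseen _).1 ⟨r, le_rfl, rfl⟩⟩

/-- The threshold algorithm wins if and only if the second visit of the best secretary takes place
after the threshold, and nobody is accepted before his first visit: between his two visits nobody
else is the best so far. -/
lemma threshold_wins_iff {m u : ℝ} {T : Fin (n + 1) × Fin 2 → ℝ} (hT : Function.Injective T) :
    (threshold (n + 1) m).Wins u (fun r => T (arrivalOrder T r)) (fun r => (arrivalOrder T r).1) ↔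
      m ≤ secondVisit T 0 ∧ NoAccept m (firstVisit T 0) T := by
  classical
  set σ := arrivalOrder T
  have h : StrictMono (T ∘ σ) := strictMono_comp_arrivalOrder hT
  set C : Fin ((n + 1) * 2) → Prop := fun r => m ≤ T (σ r) ∧
    (∀ j < (σ r).1, T (σ r) < firstVisit T j) ∧ T (σ r) = secondVisit T (σ r).1 with hC
  have hact : ∀ r, (threshold (n + 1) m).act r u
      (history (fun r => T (σ r)) (fun r => (σ r).1) r) =
        if C r then some ⟨r, le_refl r⟩ else none := by
    intro r
    have e : C r ↔ (m ≤ T (σ r) ∧ relRank (fun r => (σ r).1) r = 1 ∧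
        visit (fun r => (σ r).1) r = 2) := by
      rw [visit_eq_two_iff h, relRank_eq_one_iff h]
    rw [if_congr e rfl rfl]
    rfl
  have hround : ∀ i, ∃ r, (σ r).1 = i ∧ T (σ r) = secondVisit T i := by
    intro i
    rcases max_choice (T (i, 0)) (T (i, 1)) with h1 | h1
    · exact ⟨σ.symm (i, 0), by simp, by simp [secondVisit, h1]⟩
    · exact ⟨σ.symm (i, 1), by simp, by simp [secondVisit, h1]⟩
  have hfs : ∀ i, firstVisit T i ≤ secondVisit T i := fun i => min_le_max
  unfold Strategy.Wins
  simp only [hact]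
  constructor
  · rintro ⟨r, q, h1, h2, -, h4⟩
    have hCr : C r := by
      by_contra hne
      rw [if_neg hne] at h2
      cases h2
    rw [if_pos hCr, Option.some.injEq] at h2
    have h0 : (σ r).1 = 0 := by
      have := h4 0
      rw [← h2] at this
      exact le_antisymm this (Fin.zero_le _)
    obtain ⟨c1, c2, c3⟩ := hCr
    rw [h0] at c3
    refine ⟨c3 ▸ c1, fun i hi1 hi2 => ?_⟩
    obtain ⟨r', hr', hTr'⟩ := hround i
    have hlt : r' < r := by
      rw [← h.lt_iff_lt]
      show T (σ r') < T (σ r)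
      rw [hTr', c3]
      exact hi2.trans_le (hfs 0)
    have hn := h1 r' hlt
    by_contra hne
    push Not at hne
    rw [if_pos] at hn
    · cases hn
    · refine ⟨by rw [hTr']; exact hi1, ?_, by rw [hTr', hr']⟩
      rw [hr', hTr']
      exact hne
  · rintro ⟨h1, h2⟩
    obtain ⟨r, hr, hTr⟩ := hround 0
    refine ⟨r, ⟨r, le_refl r⟩, fun r' hr' => ?_, ?_, ⟨r, le_rfl, rfl⟩, ?_⟩
    · rw [if_neg]
      rintro ⟨c1, c2, c3⟩
      have hlt : T (σ r') < T (σ r) := h hr'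
      have hne : (0 : Fin (n + 1)) < (σ r').1 := by
        rw [Fin.pos_iff_ne_zero]
        intro h0
        rw [h0] at c3
        rw [c3, hTr] at hlt
        exact lt_irrefl _ hlt
      rw [c3] at c1 c2
      obtain ⟨j, hj1, hj2⟩ := h2 _ c1 (c2 0 hne)
      exact absurd (c2 j hj1) (not_lt.2 hj2)
    · rw [if_pos]
      refine ⟨by rw [hTr]; exact h1, fun j hj => ?_, by rw [hr, hTr]⟩
      rw [hr] at hj
      exact absurd hj (Fin.not_lt_zero j)
    · intro i
      show (σ r).1 ≤ i
      rw [hr]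
      exact Fin.zero_le i

/-! ### Conditioning on the best secretary -/

/-- Arrival times of `n + 1` secretaries from those of the best and those of the others. -/
def consTimes (p : (ℝ × ℝ) × (Fin n × Fin 2 → ℝ)) : Fin (n + 1) × Fin 2 → ℝ :=
  fun e => Fin.cases (if e.2 = 0 then p.1.1 else p.1.2) (fun i => p.2 (i, e.2)) e.1

lemma measurePreserving_consTimes : MeasurePreserving (consTimes (n := n))
    ((uniform01.prod uniform01).prod (timesLaw (Fin n × Fin 2))) (timesLaw _) := by
  have hm : Measurable (consTimes (n := n)) := by
    rw [measurable_pi_iff]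
    rintro ⟨i, c⟩
    refine Fin.cases ?_ (fun i => ?_) i
    · show Measurable fun p : (ℝ × ℝ) × (Fin n × Fin 2 → ℝ) => if c = 0 then p.1.1 else p.1.2
      split_ifs <;> fun_prop
    · show Measurable fun p : (ℝ × ℝ) × (Fin n × Fin 2 → ℝ) => p.2 (i, c)
      fun_prop
  refine ⟨hm, (Measure.pi_eq fun s hs => ?_).symm⟩
  rw [Measure.map_apply hm (MeasurableSet.univ_pi hs)]
  have e : consTimes (n := n) ⁻¹' Set.univ.pi s =
      (s (0, 0) ×ˢ s (0, 1)) ×ˢ Set.univ.pi fun e : Fin n × Fin 2 => s (e.1.succ, e.2) := by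
    ext p
    simp [consTimes, Fin.forall_fin_succ]
  rw [e, Measure.prod_prod, Measure.prod_prod, Measure.pi_pi, Fintype.prod_prod_type,
    Fintype.prod_prod_type, Fin.prod_univ_succ, Fin.prod_univ_two]

lemma firstVisit_consTimes_zero (p : (ℝ × ℝ) × (Fin n × Fin 2 → ℝ)) :
    firstVisit (consTimes p) 0 = min p.1.1 p.1.2 := by
  simp [firstVisit, consTimes]

lemma secondVisit_consTimes_zero (p : (ℝ × ℝ) × (Fin n × Fin 2 → ℝ)) :
    secondVisit (consTimes p) 0 = max p.1.1 p.1.2 := by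
  simp [secondVisit, consTimes]

/-- The best secretary must not be accepted himself, and after his first visit he keeps all others
from being accepted. -/
lemma noAccept_consTimes_iff (m x : ℝ) (p : (ℝ × ℝ) × (Fin n × Fin 2 → ℝ)) :
    NoAccept m x (consTimes p) ↔ ¬ (m ≤ max p.1.1 p.1.2 ∧ max p.1.1 p.1.2 < x) ∧
      NoAccept m (min x (min p.1.1 p.1.2)) p.2 := by
  have hf : ∀ i : Fin n, firstVisit (consTimes p) i.succ = firstVisit p.2 i := fun i => rfl
  have hs : ∀ i : Fin n, secondVisit (consTimes p) i.succ = secondVisit p.2 i := fun i => rfl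
  unfold NoAccept
  rw [Fin.forall_fin_succ]
  refine and_congr ?_ (forall_congr' fun i => ?_)
  · rw [secondVisit_consTimes_zero]
    simp only [Fin.not_lt_zero, false_and, exists_false]
    tauto
  · rw [Fin.exists_fin_succ]
    simp only [hf, hs, firstVisit_consTimes_zero, Fin.succ_pos, true_and, Fin.succ_lt_succ_iff,
      lt_min_iff (c := min p.1.1 p.1.2)]
    rw [← not_le (a := min p.1.1 p.1.2)]
    tauto

lemma measurable_firstVisit (i : Fin n) :
    Measurable fun T : Fin n × Fin 2 → ℝ => firstVisit T i := by
  unfold firstVisit; fun_prop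

lemma measurable_secondVisit (i : Fin n) :
    Measurable fun T : Fin n × Fin 2 → ℝ => secondVisit T i := by
  unfold secondVisit; fun_prop

lemma measurableSet_noAccept (m : ℝ) {x : (Fin n × Fin 2 → ℝ) → ℝ} (hx : Measurable x) :
    MeasurableSet {T : Fin n × Fin 2 → ℝ | NoAccept m (x T) T} := by
  rw [measurableSet_setOfPred]
  unfold NoAccept
  refine Measurable.forall fun i => Measurable.imp ?_ (Measurable.imp ?_
    (Measurable.exists fun j => Measurable.and measurable_const ?_))
  · rw [← measurableSet_setOfPred]
    exact measurableSet_le measurable_const (measurable_secondVisit i)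
  · rw [← measurableSet_setOfPred]; exact measurableSet_lt (measurable_secondVisit i) hx
  · rw [← measurableSet_setOfPred]
    exact measurableSet_le (measurable_firstVisit j) (measurable_secondVisit i)

/-- The probability that, with `n` secretaries, there is no second visit of a best-so-far
secretary between the times `m` and `x`. -/
def noAcceptProb (n : ℕ) (m x : ℝ) : ℝ :=
  (timesLaw (Fin n × Fin 2)).real {T | NoAccept m x T}

lemma noAcceptProb_nonneg (n : ℕ) (m x : ℝ) : 0 ≤ noAcceptProb n m x := measureReal_nonneg

lemma noAcceptProb_le_one (n : ℕ) (m x : ℝ) : noAcceptProb n m x ≤ 1 := measureReal_le_one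

lemma noAcceptProb_zero (m x : ℝ) : noAcceptProb 0 m x = 1 := by
  unfold noAcceptProb
  have : {T : Fin 0 × Fin 2 → ℝ | NoAccept m x T} = Set.univ := by
    ext T; simp [NoAccept]
  rw [this]; simp

lemma noAcceptProb_of_le {m x : ℝ} (h : x ≤ m) (n : ℕ) : noAcceptProb n m x = 1 := by
  unfold noAcceptProb
  have : {T : Fin n × Fin 2 → ℝ | NoAccept m x T} = Set.univ := by
    ext T
    simp only [Set.mem_ofPred_eq, Set.mem_univ, iff_true]
    exact fun i h1 h2 => absurd (h1.trans_lt h2) (not_lt.2 h)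
  rw [this]; simp

lemma antitone_noAcceptProb (n : ℕ) (m : ℝ) : Antitone (noAcceptProb n m) := fun _ _ hxy =>
  measureReal_mono fun _ hT i h1 h2 => hT i h1 (h2.trans_le hxy)

lemma real_timesLaw_succ {A : Set (Fin (n + 1) × Fin 2 → ℝ)} (hA : MeasurableSet A) :
    (timesLaw _).real A = ∫ p, (timesLaw (Fin n × Fin 2)).real {T | consTimes (p, T) ∈ A}
      ∂(uniform01.prod uniform01) := by
  rw [← measurePreserving_consTimes.measureReal_preimage hA.nullMeasurableSet, measureReal_def,
    Measure.prod_apply (measurePreserving_consTimes.measurable hA), ← integral_toReal]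
  · rfl
  · exact (measurable_measure_prodMk_left
      (measurePreserving_consTimes.measurable hA)).aemeasurable
  · filter_upwards with p using measure_lt_top _ _

open Classical in
lemma noAcceptProb_succ_eq_integral (n : ℕ) (m x : ℝ) :
    noAcceptProb (n + 1) m x = ∫ p : ℝ × ℝ, (if m ≤ max p.1 p.2 ∧ max p.1 p.2 < x then 0 else
      noAcceptProb n m (min x (min p.1 p.2))) ∂(uniform01.prod uniform01) := by
  rw [noAcceptProb, real_timesLaw_succ (measurableSet_noAccept m measurable_const)]
  congr 1
  ext p
  simp only [Set.mem_ofPred_eq, noAccept_consTimes_iff]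
  split_ifs with h
  · simp [h]
  · simp only [h, not_false_eq_true, true_and]; rfl

open Classical in
lemma winProb_threshold_eq_integral (n : ℕ) (m : ℝ) :
    winProb (threshold (n + 1) m) = ∫ p : ℝ × ℝ, (if m ≤ max p.1 p.2 then
      noAcceptProb n m (min p.1 p.2) else 0) ∂(uniform01.prod uniform01) := by
  have hA : MeasurableSet {T : Fin (n + 1) × Fin 2 → ℝ |
      m ≤ secondVisit T 0 ∧ NoAccept m (firstVisit T 0) T} :=
    (measurableSet_le measurable_const (measurable_secondVisit 0)).inter
      (measurableSet_noAccept m (measurable_firstVisit 0))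
  have e : winProb (threshold (n + 1) m) = (timesLaw (Fin (n + 1) × Fin 2)).real
      {T | m ≤ secondVisit T 0 ∧ NoAccept m (firstVisit T 0) T} := by
    rw [winProb]
    have e2 : (timesLaw (Fin (n + 1) × Fin 2)).real
        {T | m ≤ secondVisit T 0 ∧ NoAccept m (firstVisit T 0) T} =
        (uniform01.prod (timesLaw (Fin (n + 1) × Fin 2))).real
          {p | m ≤ secondVisit p.2 0 ∧ NoAccept m (firstVisit p.2 0) p.2} :=
      (measurePreserving_snd.measureReal_preimage hA.nullMeasurableSet).symm
    rw [e2]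
    apply measureReal_congr
    have hinj : ∀ᵐ p ∂(uniform01.prod (timesLaw (Fin (n + 1) × Fin 2))),
        Function.Injective p.2 := Measure.quasiMeasurePreserving_snd.ae (ae_injective _)
    filter_upwards [hinj] with p hp
    exact propext (threshold_wins_iff hp)
  rw [e, real_timesLaw_succ hA]
  congr 1
  ext p
  simp only [Set.mem_ofPred_eq, noAccept_consTimes_iff, firstVisit_consTimes_zero,
    secondVisit_consTimes_zero, min_self]
  have hnot : ¬ max p.1 p.2 < min p.1 p.2 := not_lt.2 min_le_max
  split_ifs with h
  · simp only [h, hnot, not_false_eq_true, true_and]; rfl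
  · simp [h]

end

section

/-! ### The recursion for the threshold algorithm -/

lemma integral_uniform01 (f : ℝ → ℝ) : ∫ x, f x ∂uniform01 = ∫ x in (0:ℝ)..1, f x := by
  rw [uniform01, integral_Ico_eq_integral_Ioc, intervalIntegral.integral_of_le zero_le_one]

lemma intervalIntegrable_of_abs_le_one {f : ℝ → ℝ} (hf : Measurable f) (hb : ∀ x, |f x| ≤ 1)
    (a b : ℝ) : IntervalIntegrable f volume a b :=
  (intervalIntegrable_const (c := (1 : ℝ))).mono_fun hf.aestronglyMeasurable
    (ae_of_all _ fun x => by simpa using hb x)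

/-- An integral over the unit square as a sum of iterated integrals. -/
lemma integral_uniform01_prod {f : ℝ × ℝ → ℝ} (hf : Measurable f) (hb : ∀ p, |f p| ≤ 1)
    {x : ℝ} (hx0 : 0 ≤ x) (hx1 : x ≤ 1) :
    ∫ p, f p ∂(uniform01.prod uniform01) =
      (∫ a in (0:ℝ)..x, ∫ b in (0:ℝ)..1, f (a, b)) + ∫ a in x..1, ∫ b in (0:ℝ)..1, f (a, b) := by
  have hint : Integrable f (uniform01.prod uniform01) :=
    Integrable.of_bound hf.aestronglyMeasurable 1 (ae_of_all _ fun p => hb p)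
  have h1 := hint.integral_prod_left
  simp only [integral_uniform01] at h1
  have h2 : IntervalIntegrable (fun a => ∫ b in (0:ℝ)..1, f (a, b)) volume 0 1 := by
    rw [intervalIntegrable_iff_integrableOn_Ico_of_le zero_le_one]
    exact h1
  rw [integral_prod _ hint, integral_uniform01]
  simp only [integral_uniform01]
  refine (intervalIntegral.integral_add_adjacent_intervals ?_ ?_).symm
  · exact h2.mono_set (by
      rw [Set.uIcc_of_le hx0, Set.uIcc_of_le zero_le_one]; exact Set.Icc_subset_Icc le_rfl hx1)
  · exact h2.mono_set (by
      rw [Set.uIcc_of_le hx1, Set.uIcc_of_le zero_le_one]; exact Set.Icc_subset_Icc hx0 le_rfl)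

variable (n : ℕ) {m : ℝ}

lemma intervalIntegrable_noAcceptProb (m a b : ℝ) :
    IntervalIntegrable (noAcceptProb n m) volume a b :=
  (antitone_noAcceptProb n m).intervalIntegrable

/-- The integral of `noAcceptProb n m` over `[0, x]`. -/
def noAcceptInt (n : ℕ) (m x : ℝ) : ℝ := ∫ a in (0:ℝ)..x, noAcceptProb n m a

/-- The average of `noAcceptProb` over a uniform second time, capped at `x`. -/
lemma integral_noAcceptProb_min {x : ℝ} (hx0 : 0 ≤ x) (hx1 : x ≤ 1) :
    ∫ b in (0:ℝ)..1, noAcceptProb n m (min x b) =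
      noAcceptInt n m x + (1 - x) * noAcceptProb n m x := by
  have hanti : Antitone fun b => noAcceptProb n m (min x b) := fun b c h =>
    antitone_noAcceptProb n m (min_le_min_left x h)
  rw [← intervalIntegral.integral_add_adjacent_intervals (b := x) hanti.intervalIntegrable
    hanti.intervalIntegrable]
  congr 1
  · apply intervalIntegral.integral_congr_Ioo_of_le hx0
    intro b hb
    show noAcceptProb n m (min x b) = _
    rw [min_eq_right hb.2.le]
  · rw [intervalIntegral.integral_congr_Ioo_of_le (g := fun _ => noAcceptProb n m x) hx1]
    · simp
    · intro b hb
      show noAcceptProb n m (min x b) = _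
      rw [min_eq_left hb.1.le]

lemma abs_noAcceptProb_le_one (m x : ℝ) : |noAcceptProb n m x| ≤ 1 := by
  rw [abs_of_nonneg (noAcceptProb_nonneg _ _ _)]; exact noAcceptProb_le_one _ _ _

lemma measurable_noAcceptProb (m : ℝ) : Measurable (noAcceptProb n m) :=
  (antitone_noAcceptProb n m).measurable

open Classical in
/-- The recursion obtained by conditioning on the two visits of the best secretary. -/
lemma noAcceptProb_succ {x : ℝ} (hm0 : 0 ≤ m) (hmx : m ≤ x) (hx1 : x ≤ 1) :
    noAcceptProb (n + 1) m x = (1 - x) ^ 2 * noAcceptProb n m x + m ^ 2 +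
      2 * (1 - x) * noAcceptInt n m x := by
  have hx0 : 0 ≤ x := hm0.trans hmx
  set f : ℝ × ℝ → ℝ := fun p => if m ≤ max p.1 p.2 ∧ max p.1 p.2 < x then 0 else
    noAcceptProb n m (min x (min p.1 p.2)) with hf
  have hfm : Measurable f := by
    refine Measurable.ite (MeasurableSet.inter (s₁ := {p : ℝ × ℝ | m ≤ max p.1 p.2})
      (s₂ := {p : ℝ × ℝ | max p.1 p.2 < x}) ?_ ?_) measurable_const
        ((measurable_noAcceptProb n m).comp (by fun_prop))
    · exact measurableSet_le measurable_const (by fun_prop)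
    · exact measurableSet_lt (by fun_prop) measurable_const
  have hfb : ∀ p, |f p| ≤ 1 := by
    intro p
    simp only [hf]
    split_ifs
    · simp
    · exact abs_noAcceptProb_le_one _ _ _
  -- a visit at time `a ≥ x`
  have h1 : ∀ a, x ≤ a → ∫ b in (0:ℝ)..1, f (a, b) =
      noAcceptInt n m x + (1 - x) * noAcceptProb n m x := by
    intro a ha
    rw [← integral_noAcceptProb_min n hx0 hx1]
    refine intervalIntegral.integral_congr fun b _ => ?_
    simp only [hf]
    rw [if_neg fun h => absurd h.2 (not_lt.2 (ha.trans (le_max_left a b))), ← min_assoc,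
      min_eq_left ha]
  -- a visit at time `a < x`
  have h2 : ∀ a ∈ Set.Ioo 0 x, ∫ b in (0:ℝ)..1, f (a, b) =
      (if a < m then m else 0) + (1 - x) * noAcceptProb n m a := by
    intro a ha
    have hfa : ∀ c d, IntervalIntegrable (fun b => f (a, b)) volume c d :=
      intervalIntegrable_of_abs_le_one (hfm.comp (by fun_prop)) fun b => hfb _
    rw [← intervalIntegral.integral_add_adjacent_intervals (hfa 0 x) (hfa x 1),
      ← intervalIntegral.integral_add_adjacent_intervals (hfa 0 m) (hfa m x)]
    have e1 : ∫ b in x..1, f (a, b) = (1 - x) * noAcceptProb n m a := by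
      rw [intervalIntegral.integral_congr_Ioo_of_le (g := fun _ => noAcceptProb n m a) hx1]
      · simp
      · intro b hb
        simp only [hf]
        rw [if_neg fun h => absurd h.2 (not_lt.2 (hb.1.le.trans (le_max_right a b))),
          min_eq_left (ha.2.le.trans hb.1.le), min_eq_right ha.2.le]
    have e2 : ∫ b in m..x, f (a, b) = 0 := by
      rw [intervalIntegral.integral_congr_Ioo_of_le (g := fun _ => (0 : ℝ)) hmx]
      · simp
      · intro b hb
        simp only [hf]
        rw [if_pos ⟨hb.1.le.trans (le_max_right a b), max_lt ha.2 hb.2⟩]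
    have e3 : ∫ b in (0:ℝ)..m, f (a, b) = if a < m then m else 0 := by
      rw [intervalIntegral.integral_congr_Ioo_of_le (g := fun _ => if a < m then (1 : ℝ) else 0)
        hm0]
      · split_ifs <;> simp
      · intro b hb
        simp only [hf]
        by_cases ham : a < m
        · rw [if_neg fun h => absurd h.1 (not_le.2 (max_lt ham hb.2)), if_pos ham,
            noAcceptProb_of_le ((min_le_right _ _).trans ((min_le_left _ _).trans ham.le))]
        · rw [if_neg ham, if_pos ⟨(not_lt.1 ham).trans (le_max_left a b),
            max_lt ha.2 (hb.2.trans_le hmx)⟩]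
    rw [e1, e2, e3, add_zero]
  rw [noAcceptProb_succ_eq_integral, integral_uniform01_prod hfm hfb hx0 hx1,
    intervalIntegral.integral_congr_Ioo_of_le hx1 (fun a ha => h1 a ha.1.le),
    intervalIntegral.integral_congr_Ioo_of_le hx0 h2]
  have hite : ∀ c d, IntervalIntegrable (fun a => if a < m then m else 0) volume c d := by
    have hm : Measurable fun a : ℝ => if a < m then m else 0 :=
      Measurable.ite measurableSet_Iio measurable_const measurable_const
    refine intervalIntegrable_of_abs_le_one hm fun a => ?_
    split_ifs
    · rw [abs_of_nonneg hm0]; linarith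
    · simp
  have e4 : ∫ a in (0:ℝ)..x, (if a < m then m else 0) = m ^ 2 := by
    rw [← intervalIntegral.integral_add_adjacent_intervals (hite 0 m) (hite m x),
      intervalIntegral.integral_congr_Ioo_of_le (g := fun _ => m) hm0
        (fun a ha => if_pos ha.2),
      intervalIntegral.integral_congr_Ioo_of_le (g := fun _ => 0) hmx
        (fun a ha => if_neg (not_lt.2 ha.1.le))]
    simp [sq]
  rw [intervalIntegral.integral_add (hite _ _)
    ((intervalIntegrable_noAcceptProb n m _ _).const_mul _), e4,
    intervalIntegral.integral_const_mul, intervalIntegral.integral_const,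
    show ∫ a in (0:ℝ)..x, noAcceptProb n m a = noAcceptInt n m x from rfl, smul_eq_mul]
  ring

open Classical in
/-- The winning probability, by conditioning on the two visits of the best secretary. -/
lemma winProb_threshold_succ (hm0 : 0 ≤ m) (hm1 : m ≤ 1) :
    winProb (threshold (n + 1) m) = m * (1 - m) +
      ∫ a in m..1, (noAcceptInt n m a + (1 - a) * noAcceptProb n m a) := by
  set f : ℝ × ℝ → ℝ := fun p => if m ≤ max p.1 p.2 then noAcceptProb n m (min p.1 p.2) else 0
    with hf
  have hfm : Measurable f :=
    Measurable.ite (measurableSet_le measurable_const (by fun_prop))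
      ((measurable_noAcceptProb n m).comp (by fun_prop)) measurable_const
  have hfb : ∀ p, |f p| ≤ 1 := by
    intro p
    simp only [hf]
    split_ifs
    · exact abs_noAcceptProb_le_one _ _ _
    · simp
  have h1 : ∀ a ∈ Set.Ioo m 1, ∫ b in (0:ℝ)..1, f (a, b) =
      noAcceptInt n m a + (1 - a) * noAcceptProb n m a := by
    intro a ha
    rw [← integral_noAcceptProb_min n (hm0.trans ha.1.le) ha.2.le]
    refine intervalIntegral.integral_congr fun b _ => ?_
    simp only [hf]
    rw [if_pos (ha.1.le.trans (le_max_left a b))]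
  have h2 : ∀ a ∈ Set.Ioo 0 m, ∫ b in (0:ℝ)..1, f (a, b) = 1 - m := by
    intro a ha
    have hfa : ∀ c d, IntervalIntegrable (fun b => f (a, b)) volume c d :=
      intervalIntegrable_of_abs_le_one (hfm.comp (by fun_prop)) fun b => hfb _
    rw [← intervalIntegral.integral_add_adjacent_intervals (hfa 0 m) (hfa m 1),
      intervalIntegral.integral_congr_Ioo_of_le (g := fun _ => (0 : ℝ)) hm0,
      intervalIntegral.integral_congr_Ioo_of_le (g := fun _ => (1 : ℝ)) hm1]
    · simp
    · intro b hb
      simp only [hf]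
      rw [if_pos (hb.1.le.trans (le_max_right a b)),
        noAcceptProb_of_le ((min_le_left _ _).trans ha.2.le)]
    · intro b hb
      simp only [hf]
      rw [if_neg (not_le.2 (max_lt ha.2 hb.2))]
  rw [winProb_threshold_eq_integral, integral_uniform01_prod hfm hfb hm0 hm1,
    intervalIntegral.integral_congr_Ioo_of_le hm1 h1,
    intervalIntegral.integral_congr_Ioo_of_le hm0 h2, intervalIntegral.integral_const,
    smul_eq_mul, sub_zero]

end

section

/-! ### The limit of many secretaries -/

variable {m : ℝ}

/-- The recursion is monotone, and its first step decreases. -/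
lemma noAcceptProb_succ_le (hm0 : 0 ≤ m) (n : ℕ) {x : ℝ} (hx : x ≤ 1) :
    noAcceptProb (n + 1) m x ≤ noAcceptProb n m x := by
  induction n generalizing x with
  | zero => rw [noAcceptProb_zero]; exact noAcceptProb_le_one _ _ _
  | succ n ih =>
    rcases le_total x m with hxm | hmx
    · rw [noAcceptProb_of_le hxm, noAcceptProb_of_le hxm]
    · have h1 := ih hx
      have h2 : noAcceptInt (n + 1) m x ≤ noAcceptInt n m x :=
        intervalIntegral.integral_mono_on (hm0.trans hmx)
          (intervalIntegrable_noAcceptProb _ _ _ _) (intervalIntegrable_noAcceptProb _ _ _ _)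
          fun a ha => ih (ha.2.trans hx)
      have h3 := mul_le_mul_of_nonneg_left h1 (sq_nonneg (1 - x))
      have h4 := mul_le_mul_of_nonneg_left h2 (by linarith : 0 ≤ 2 * (1 - x))
      have e1 := noAcceptProb_succ (n + 1) hm0 hmx hx
      have e2 := noAcceptProb_succ n hm0 hmx hx
      linarith

/-- The limit of `noAcceptProb n m x` for many secretaries. -/
def noAcceptLim (m x : ℝ) : ℝ := ⨅ n, noAcceptProb n m x

lemma tendsto_noAcceptProb (hm0 : 0 ≤ m) {x : ℝ} (hx : x ≤ 1) :
    Tendsto (fun n => noAcceptProb n m x) atTop (𝓝 (noAcceptLim m x)) :=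
  tendsto_atTop_ciInf (antitone_nat_of_succ_le fun n => noAcceptProb_succ_le hm0 n hx)
    ⟨0, by rintro _ ⟨n, rfl⟩; exact noAcceptProb_nonneg n m x⟩

lemma bddBelow_noAcceptProb (m x : ℝ) : BddBelow (Set.range fun n => noAcceptProb n m x) :=
  ⟨0, by rintro _ ⟨n, rfl⟩; exact noAcceptProb_nonneg n m x⟩

lemma noAcceptLim_le_one (m x : ℝ) : noAcceptLim m x ≤ 1 :=
  (ciInf_le (bddBelow_noAcceptProb m x) 0).trans (noAcceptProb_le_one _ _ _)

lemma noAcceptLim_of_le {x : ℝ} (h : x ≤ m) : noAcceptLim m x = 1 := by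
  simp [noAcceptLim, noAcceptProb_of_le h]

lemma antitone_noAcceptLim (m : ℝ) : Antitone (noAcceptLim m) := fun _ y hxy =>
  ciInf_mono (bddBelow_noAcceptProb m y) fun n => antitone_noAcceptProb n m hxy

/-- The integral of `noAcceptLim m` over `[0, x]`. -/
def noAcceptLimInt (m x : ℝ) : ℝ := ∫ a in (0:ℝ)..x, noAcceptLim m a

lemma tendsto_noAcceptInt (hm0 : 0 ≤ m) {x : ℝ} (hx0 : 0 ≤ x) (hx : x ≤ 1) :
    Tendsto (fun n => noAcceptInt n m x) atTop (𝓝 (noAcceptLimInt m x)) := by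
  refine intervalIntegral.tendsto_integral_filter_of_dominated_convergence (fun _ => (1 : ℝ))
    (Eventually.of_forall fun n => (measurable_noAcceptProb n m).aestronglyMeasurable)
    (Eventually.of_forall fun n => ae_of_all _ fun a _ => abs_noAcceptProb_le_one n m a)
    intervalIntegrable_const (ae_of_all _ fun a ha => ?_)
  rw [Set.uIoc_of_le hx0] at ha
  exact tendsto_noAcceptProb hm0 (ha.2.trans hx)

lemma noAcceptLimInt_le {x : ℝ} (hx0 : 0 ≤ x) : noAcceptLimInt m x ≤ x := by
  calc noAcceptLimInt m x ≤ ∫ _ in (0:ℝ)..x, (1 : ℝ) :=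
        intervalIntegral.integral_mono_on hx0 (antitone_noAcceptLim m).intervalIntegrable
          intervalIntegrable_const fun a _ => noAcceptLim_le_one m a
    _ = x := by simp

lemma noAcceptLimInt_self (hm0 : 0 ≤ m) : noAcceptLimInt m m = m := by
  unfold noAcceptLimInt
  rw [intervalIntegral.integral_congr_Ioo_of_le (g := fun _ => 1) hm0]
  · simp
  · exact fun a ha => noAcceptLim_of_le ha.2.le

lemma continuous_noAcceptLimInt (m : ℝ) : Continuous (noAcceptLimInt m) :=
  intervalIntegral.continuous_primitive
    (fun _ _ => (antitone_noAcceptLim m).intervalIntegrable) 0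

/-- The fixed-point equation of the recursion. -/
lemma seenProb_mul_noAcceptLim (hm0 : 0 ≤ m) {x : ℝ} (hmx : m ≤ x) (hx1 : x ≤ 1) :
    seenProb x * noAcceptLim m x = m ^ 2 + 2 * (1 - x) * noAcceptLimInt m x := by
  have h1 := (tendsto_noAcceptProb hm0 hx1).comp (tendsto_add_atTop_nat 1)
  have h2 := (((tendsto_noAcceptProb hm0 hx1).const_mul ((1 - x) ^ 2)).add_const (m ^ 2)).add
    ((tendsto_noAcceptInt hm0 (hm0.trans hmx) hx1).const_mul (2 * (1 - x)))
  have h3 := tendsto_nhds_unique (h1.congr fun n => noAcceptProb_succ n hm0 hmx hx1) h2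
  unfold seenProb
  linear_combination h3

lemma hasDerivAt_noAcceptLimInt (hm0 : 0 ≤ m) {x : ℝ} (hx : x ∈ Set.Ioo m 1) :
    HasDerivAt (noAcceptLimInt m) (noAcceptLim m x) x := by
  have hD : seenProb x ≠ 0 := (seenProb_pos (hm0.trans_lt hx.1) hx.2.le).ne'
  have hcont : ContinuousAt (noAcceptLim m) x := by
    have h : ContinuousAt
        (fun y => (m ^ 2 + 2 * (1 - y) * noAcceptLimInt m y) / seenProb y) x := by
      have h1 := (continuous_noAcceptLimInt m).continuousAt (x := x)
      have h2 := (hasDerivAt_seenProb x).continuousAt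
      exact ContinuousAt.div (by fun_prop) h2 hD
    refine h.congr ?_
    filter_upwards [Ioo_mem_nhds hx.1 hx.2] with y hy
    have hDy : seenProb y ≠ 0 := (seenProb_pos (hm0.trans_lt hy.1) hy.2.le).ne'
    rw [← seenProb_mul_noAcceptLim hm0 hy.1.le hy.2.le]
    field_simp
  exact intervalIntegral.integral_hasDerivAt_right
    (antitone_noAcceptLim m).intervalIntegrable
    ((antitone_noAcceptLim m).measurable.stronglyMeasurable.stronglyMeasurableAtFilter) hcont

/-- The linear differential equation for `noAcceptLimInt` expresses its integral up to the end of
time by its value at any earlier time. -/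
lemma integral_noAcceptLimInt (hm0 : 0 ≤ m) {c : ℝ} (hmc : m ≤ c) (hc0 : 0 < c) (hc1 : c ≤ 1) :
    ∫ x in c..1, noAcceptLimInt m x =
      noAcceptLimInt m c * seenTail c / seenProb c + m ^ 2 * rejectRatio c := by
  have hcont : ContinuousOn (fun x => noAcceptLimInt m x * seenTail x / seenProb x +
      m ^ 2 * rejectRatio x) (Set.Icc c 1) := by
    intro x hx
    have hx0 : 0 < x := hc0.trans_le hx.1
    have h1 := (continuous_noAcceptLimInt m).continuousAt (x := x)
    have h2 := (hasDerivAt_seenProb x).continuousAt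
    have h3 := (hasDerivAt_seenTail x).continuousAt
    have h4 := (hasDerivAt_rejectRatio hx0 hx.2).continuousAt
    exact (((h1.mul h3).div h2 (seenProb_pos hx0 hx.2).ne').add
      (h4.const_mul _)).continuousWithinAt
  have hderiv : ∀ x ∈ Set.Ioo c 1, HasDerivAt (fun x => noAcceptLimInt m x * seenTail x /
      seenProb x + m ^ 2 * rejectRatio x) (-noAcceptLimInt m x) x := by
    intro x hx
    have hx0 : 0 < x := hc0.trans hx.1
    have hD : seenProb x ≠ 0 := (seenProb_pos hx0 hx.2.le).ne'
    have h1 := hasDerivAt_noAcceptLimInt hm0 ⟨hmc.trans_lt hx.1, hx.2⟩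
    have := ((h1.mul (hasDerivAt_seenTail x)).div (hasDerivAt_seenProb x) hD).add
      ((hasDerivAt_rejectRatio hx0 hx.2.le).const_mul (m ^ 2))
    refine this.congr_deriv ?_
    have hfix := seenProb_mul_noAcceptLim hm0 (hmc.trans hx.1.le) hx.2.le
    simp only [Pi.mul_apply]
    field_simp
    linear_combination (seenTail x) * hfix
  have h := intervalIntegral.integral_eq_sub_of_hasDerivAt_of_le hc1 hcont hderiv
    ((continuous_noAcceptLimInt m).neg.intervalIntegrable _ _)
  rw [intervalIntegral.integral_neg] at h
  have e1 : seenTail 1 = 0 := by norm_num [seenTail]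
  simp only [e1, rejectRatio_one, mul_zero, zero_div, add_zero] at h
  linarith

lemma tendsto_winProb_threshold (hm0 : 0 ≤ m) (hm1 : m ≤ 1) :
    Tendsto (fun n => winProb (threshold n m)) atTop (𝓝 (2 * ∫ x in m..1, noAcceptLimInt m x)) := by
  rw [← tendsto_add_atTop_iff_nat 1]
  have h1 : Tendsto (fun n => m * (1 - m) +
      ∫ a in m..1, (noAcceptInt n m a + (1 - a) * noAcceptProb n m a)) atTop
      (𝓝 (m * (1 - m) + ∫ a in m..1, (noAcceptLimInt m a + (1 - a) * noAcceptLim m a))) := by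
    refine Tendsto.const_add _ ?_
    refine intervalIntegral.tendsto_integral_filter_of_dominated_convergence (fun _ => (2 : ℝ))
      (Eventually.of_forall fun n => ?_) (Eventually.of_forall fun n => ae_of_all _ fun a ha => ?_)
      intervalIntegrable_const (ae_of_all _ fun a ha => ?_)
    · have hc : Continuous (noAcceptInt n m) := intervalIntegral.continuous_primitive
        (fun _ _ => intervalIntegrable_noAcceptProb n m _ _) 0
      exact (hc.measurable.add ((measurable_const.sub measurable_id).mul
        (measurable_noAcceptProb n m))).aestronglyMeasurable
    · rw [Set.uIoc_of_le hm1] at ha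
      have ha0 : 0 ≤ a := hm0.trans ha.1.le
      have h2 := noAcceptProb_nonneg n m a
      have h3 := noAcceptProb_le_one n m a
      have h4 : 0 ≤ noAcceptInt n m a :=
        intervalIntegral.integral_nonneg ha0 fun x _ => noAcceptProb_nonneg n m x
      have h5 : noAcceptInt n m a ≤ a := by
        calc noAcceptInt n m a ≤ ∫ _ in (0:ℝ)..a, (1 : ℝ) :=
              intervalIntegral.integral_mono_on ha0 (intervalIntegrable_noAcceptProb n m _ _)
                intervalIntegrable_const fun x _ => noAcceptProb_le_one n m x
          _ = a := by simp
      have h6 : 0 ≤ 1 - a := by linarith [ha.2]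
      rw [Real.norm_of_nonneg (by positivity)]
      nlinarith [ha.2]
    · rw [Set.uIoc_of_le hm1] at ha
      exact (tendsto_noAcceptInt hm0 (hm0.trans ha.1.le) ha.2).add
        ((tendsto_noAcceptProb hm0 ha.2).const_mul _)
  have hcont := continuous_noAcceptLimInt m
  have hint : IntervalIntegrable (noAcceptLimInt m) volume m 1 := hcont.intervalIntegrable _ _
  have hint2 : IntervalIntegrable (fun a => (1 - a) * noAcceptLim m a) volume m 1 :=
    ((antitone_noAcceptLim m).intervalIntegrable).continuousOn_mul (by fun_prop)
  -- integration by parts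
  have h2 : ∫ a in m..1, ((1 - a) * noAcceptLim m a - noAcceptLimInt m a) = - (m * (1 - m)) := by
    rw [intervalIntegral.integral_eq_sub_of_hasDerivAt_of_le
      (f := fun a => (1 - a) * noAcceptLimInt m a) hm1 (by fun_prop)]
    · rw [noAcceptLimInt_self hm0]; ring
    · intro a ha
      have := ((hasDerivAt_id a).const_sub 1).mul (hasDerivAt_noAcceptLimInt hm0 ha)
      refine this.congr_deriv ?_
      simp; ring
    · exact hint2.sub hint
  have e : m * (1 - m) + ∫ a in m..1, (noAcceptLimInt m a + (1 - a) * noAcceptLim m a) =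
      2 * ∫ x in m..1, noAcceptLimInt m x := by
    rw [intervalIntegral.integral_sub hint2 hint] at h2
    rw [intervalIntegral.integral_add hint hint2]
    linarith
  rw [← e]
  exact h1.congr fun n => (winProb_threshold_succ n hm0 hm1).symm

/-- The limit is evaluated by the differential equation, started at the threshold. -/
lemma tendsto_winProb_threshold_limitProb (hm0 : 0 < m) (hm1 : m ≤ 1) :
    Tendsto (fun n => winProb (threshold n m)) atTop (𝓝 (limitProb m)) := by
  have h := tendsto_winProb_threshold hm0.le hm1
  rw [integral_noAcceptLimInt hm0.le le_rfl hm0 hm1, noAcceptLimInt_self hm0.le] at h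
  convert h using 2
  unfold limitProb seenProb
  have : 2 - m ≠ 0 := by linarith
  field_simp

/-- Without a waiting period the winning probability stays bounded away from the optimum.  Here
`seenProb` vanishes at the threshold, so the differential equation is only used from `0.01` on. -/
lemma tendsto_winProb_threshold_zero :
    ∃ c ≤ 0.7, Tendsto (fun n => winProb (threshold n 0)) atTop (𝓝 c) := by
  refine ⟨_, ?_, tendsto_winProb_threshold le_rfl zero_le_one⟩
  have hint : ∀ a b, IntervalIntegrable (noAcceptLimInt 0) volume a b := fun a b =>
    (continuous_noAcceptLimInt 0).intervalIntegrable a b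
  rw [← intervalIntegral.integral_add_adjacent_intervals (hint 0 0.01) (hint 0.01 1),
    integral_noAcceptLimInt le_rfl (by norm_num) (by norm_num) (by norm_num)]
  have h1 : ∫ x in (0:ℝ)..0.01, noAcceptLimInt 0 x ≤ ∫ _ in (0:ℝ)..0.01, (0.01 : ℝ) :=
    intervalIntegral.integral_mono_on (by norm_num) (hint _ _) intervalIntegrable_const
      fun x hx => (noAcceptLimInt_le hx.1).trans hx.2
  have h2 := noAcceptLimInt_le (m := 0) (x := 0.01) (by norm_num)
  rw [intervalIntegral.integral_const] at h1
  norm_num [seenTail, seenProb] at h1 h2 ⊢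
  linarith

lemma winProb_threshold_succ_le (hm0 : 0 ≤ m) (hm1 : m ≤ 1) (n : ℕ) :
    winProb (threshold (n + 2) m) ≤ winProb (threshold (n + 1) m) := by
  rw [winProb_threshold_succ _ hm0 hm1, winProb_threshold_succ _ hm0 hm1]
  have hc : ∀ n, Continuous (noAcceptInt n m) := fun n => intervalIntegral.continuous_primitive
    (fun _ _ => intervalIntegrable_noAcceptProb n m _ _) 0
  have hint : ∀ n, IntervalIntegrable (fun a => noAcceptInt n m a + (1 - a) * noAcceptProb n m a)
      volume m 1 := fun n => ((hc n).intervalIntegrable _ _).add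
        ((intervalIntegrable_noAcceptProb n m _ _).continuousOn_mul (by fun_prop))
  gcongr
  refine intervalIntegral.integral_mono_on hm1 (hint _) (hint _) fun a ha => ?_
  have ha0 : 0 ≤ 1 - a := by linarith [ha.2]
  have h1 : noAcceptInt (n + 1) m a ≤ noAcceptInt n m a :=
    intervalIntegral.integral_mono_on (hm0.trans ha.1)
      (intervalIntegrable_noAcceptProb _ _ _ _) (intervalIntegrable_noAcceptProb _ _ _ _)
      fun x hx => noAcceptProb_succ_le hm0 n (hx.2.trans ha.2)
  have h2 := noAcceptProb_succ_le hm0 n ha.2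
  gcongr

lemma limitProb_le_winProb_threshold (hm0 : 0 < m) (hm1 : m ≤ 1) {n : ℕ} (hn : 1 ≤ n) :
    limitProb m ≤ winProb (threshold n m) := by
  obtain ⟨k, rfl⟩ := Nat.exists_eq_add_of_le' hn
  have hanti : Antitone fun n => winProb (threshold (n + 1) m) :=
    antitone_nat_of_succ_le fun n => winProb_threshold_succ_le hm0.le hm1 n
  exact hanti.le_of_tendsto
    ((tendsto_add_atTop_iff_nat 1).2 (tendsto_winProb_threshold_limitProb hm0 hm1)) k

end

end ReturningSecretary

end

theorem mainTheorem1 :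
    ∃ μ L : ℝ,
      |μ - 0.272626| ≤ 0.0000005 ∧
      |L - 0.767974| ≤ 0.0000005 ∧
      -- the threshold algorithm is asymptotically optimal for the threshold `μ` and for no other
      (∀ m ∈ Set.Ico (0 : ℝ) 1,
        ReturningSecretary.AsymptoticallyOptimal
          (fun n => ReturningSecretary.threshold n m) ↔ m = μ) ∧
      -- the optimal probability has the same limit in both models, reached by the algorithm
      Filter.Tendsto (fun n => ReturningSecretary.winProb (ReturningSecretary.threshold n μ))
        Filter.atTop (nhds L) ∧
      Filter.Tendsto ReturningSecretary.optimal Filter.atTop (nhds L) ∧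
      Filter.Tendsto ReturningSecretary.optimalOrder Filter.atTop (nhds L) ∧
      -- for `μ` and its rounded value the bound holds for every number of secretaries
      (∀ m : ℝ, |m - 0.272626| ≤ 0.0000005 → ∀ n : ℕ, 1 ≤ n →
        0.76797 ≤ ReturningSecretary.winProb (ReturningSecretary.threshold n m)) := by
  open ReturningSecretary in
  obtain ⟨μ, hμl, hμu, hμ⟩ := exists_rejectRatio_eq_half
  have hμ0 : 0 < μ := by linarith
  have hμ1 : μ < 1 := by linarith
  have hL := abs_limitProb_sub_le hμl hμu hμ
  have hthr : Tendsto (fun n => winProb (threshold n μ)) atTop (𝓝 (limitProb μ)) :=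
    tendsto_winProb_threshold_limitProb hμ0 hμ1.le
  have hle1 : ∀ n, winProb (threshold n μ) ≤ optimal n := fun n =>
    le_ciSup (bddAbove_winProb n) (threshold n μ)
  have hord : Tendsto optimalOrder atTop (𝓝 (limitProb μ)) := by
    rw [tendsto_order]
    refine ⟨fun a ha => ?_, fun a ha => ?_⟩
    · filter_upwards [hthr.eventually_const_lt ha] with n hn
      exact hn.trans_le ((hle1 n).trans (optimal_le_optimalOrder n))
    · filter_upwards [eventually_optimalOrder_lt hμ0 hμ1 hμ (ε := a - limitProb μ)
        (by linarith)] with n hn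
      linarith
  -- the threshold algorithm and the dual bound squeeze both optimal probabilities
  have hopt : Tendsto optimal atTop (𝓝 (limitProb μ)) :=
    tendsto_of_tendsto_of_tendsto_of_le_of_le hthr hord hle1 optimal_le_optimalOrder
  refine ⟨μ, limitProb μ, abs_le.2 ⟨by linarith, by linarith⟩, hL, fun m hm => ⟨fun h => ?_, ?_⟩,
    hthr, hopt, hord, fun m hm n hn => ?_⟩
  · have hlim : Tendsto (fun n => winProb (threshold n m)) atTop (𝓝 (limitProb μ)) := by
      have := hopt.sub h
      simpa using this
    by_contra hne
    rcases hm.1.eq_or_lt with h0 | h0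
    · obtain ⟨c, hc, hc2⟩ := tendsto_winProb_threshold_zero
      rw [← h0] at hlim
      have := tendsto_nhds_unique hlim hc2
      have := (abs_le.1 hL).1
      norm_num at *
      linarith
    · have := tendsto_nhds_unique hlim (tendsto_winProb_threshold_limitProb h0 hm.2.le)
      exact (limitProb_lt hμ0 hμ1 hμ h0 hm.2 hne).ne this.symm
  · rintro rfl
    have := hopt.sub hthr
    rw [sub_self] at this
    exact this
  · have h := abs_le.1 hm
    exact (le_limitProb_of_abs_le hm).trans (limitProb_le_winProb_threshold
      (by linarith [h.1]) (by linarith [h.2]) hn)
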